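/- Let $G$ be a finite group acting linearly on a complex vector space $V$ with basis $v_1,\dots,v_n$, and suppose that the action is diagonal: ${}^g v_i=\lambda_{g,i}v_i$ with $\lambda_{g,i}\in\mathbb{C}$ for all $g\in G$ and $1\le i\le n$. Let $\mathbf q=(q_{ij})_{1\le i,j\le n}$ be nonzero complex numbers with $q_{ii}=1$ and $q_{ji}=q_{ij}^{-1}$ for all $i,j$, and let $\alpha:G\times G\to\mathbb{C}^\times$ be a normalized $2$-cocycle, i.e. $\alpha(g,h)\alpha(gh,k)=\alpha(h,k)\alpha(g,hk)$ and $\alpha(g,1)=1=\alpha(1,g)$ for all $g,h,k\in G$. For an algebra $A$ on which $G$ acts by automorphisms, $A\#_\alpha G$ is the vector space $A\otimes\mathbb{C}G$ with product $(a\,t_g)(b\,t_h)=\alpha(g,h)\,a\,({}^g b)\,t_{gh}$, where $a\,t_g=a\otimes g$; the twisted group algebra is $\mathbb{C}^\alpha G=\mathbb{C}\#_\alpha G$ (trivial action), with basis $(t_g)_{g\in G}$. Let $T(V)$ be the tensor algebra and $S_{\mathbf q}(V)=\mathbb{C}\langle v_1,\dots,v_n\mid v_iv_j=q_{ij}v_jv_i\text{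 for all }i,j\rangle$; the action of $G$ on $V$ extends to actions on both by algebra automorphisms. For a bilinear map $\kappa:V\times V\to\mathbb{C}^\alpha G$ with $\kappa(v_i,v_j)=-q_{ij}\kappa(v_j,v_i)$ for all $i,j$, set \[ \mathcal H_{\mathbf q,\kappa,\alpha}=T(V)\#_\alpha G\,/\,\bigl(v_iv_j-q_{ij}v_jv_i-\kappa(v_i,v_j)\mid 1\le i,j\le n\bigr), \] filtered by giving each $v_i$ degree $1$ and each $t_g$ degree $0$. It is called a twisted quantum Drinfeld Hecke algebra if its associated graded algebra is isomorphic, as a graded algebra, to $S_{\mathbf q}(V)\#_\alpha G$. Let $\mathcal R$ be a complete set of representatives of the conjugacy classes of $G$ and, for $a\in\mathcal R$, let $[G/C_G(a)]$ be a complete set of representatives of the left cosets of the centralizer $C_G(a)$ of $a$ in $G$. \textbf{Theorem.} The bilinear maps $\kappa:V\times V\to\mathbb{C}^\alpha G$ with $\kappa(v_i,v_j)=-q_{ij}\kappa(v_j,v_i)$ for all $i,j$ for which $\mathcal H_{\mathbf q,\kappa,\alpha}$ is a twisted quantum Drinfeld Hecke algebra form a vector space, with basis consisting of the bilinear maps $f_{r,s,a}$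 determined by \[ f_{r,s,a}(v_i,v_j)=(\delta_{i,r}\delta_{j,s}-q_{sr}\delta_{i,s}\delta_{j,r})\sum_{g\in[G/C_G(a)]}\frac{\alpha(g,a)}{\alpha(gag^{-1},g)}\,\lambda_{g,r}^{-1}\lambda_{g,s}^{-1}\;t_{gag^{-1}}\qquad(1\le i,j\le n), \] where $(r,s,a)$ runs over all triples with $1\le r<s\le n$ and $a\in\mathcal R$ such that $q_{rr'}q_{sr'}=\lambda_{a,r'}$ for all $r'\notin\{r,s\}$ and $\lambda_{h,r}\lambda_{h,s}=\dfrac{\alpha(h,a)}{\alpha(a,h)}$ for all $h\in C_G(a)$. -/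

import Mathlib

open scoped DirectSum

noncomputable section

/-! ### Two-cocycles and twisted skew group algebras -/

/-- A normalized 2-cocycle on a group `G` with values in `ℂˣ` (trivial action). -/
structure NormalizedTwoCocycle (G : Type*) [Group G] where
  toFun : G → G → ℂˣ
  cocycle : ∀ a b c : G, toFun a b * toFun (a * b) c = toFun b c * toFun a (b * c)
  map_one_right : ∀ g : G, toFun g 1 = 1
  map_one_left : ∀ g : G, toFun 1 g = 1

instance (G : Type*) [Group G] : CoeFun (NormalizedTwoCocycle G) (fun _ => G → G → ℂˣ) :=
  ⟨NormalizedTwoCocycle.toFun⟩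

/-- The twisted skew group algebra `A #_α G` for an action `φ` of `G` on the algebra `A` by algebra
automorphisms. As a vector space it is `A ⊗ ℂG`, realised as the finitely supported functions
`G →₀ A`; the function supported at `g` with value `a` is the element `a t_g`. -/
def TwistedSkewGroupAlgebra {G A : Type*} [Group G] [Ring A] [Algebra ℂ A]
    (_φ : G →* (A ≃ₐ[ℂ] A)) (_α : NormalizedTwoCocycle G) : Type _ := G →₀ A

namespace TwistedSkewGroupAlgebra

section

variable {G A : Type*} [Group G] [Ring A] [Algebra ℂ A]
variable (φ : G →* (A ≃ₐ[ℂ] A)) (α : NormalizedTwoCocycle G)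

instance : AddCommGroup (TwistedSkewGroupAlgebra φ α) := inferInstanceAs (AddCommGroup (G →₀ A))

instance : Module ℂ (TwistedSkewGroupAlgebra φ α) := inferInstanceAs (Module ℂ (G →₀ A))

/-- `term φ α g a` is the element `a t_g`. -/
def term (g : G) : A →ₗ[ℂ] TwistedSkewGroupAlgebra φ α := Finsupp.lsingle (M := A) (R := ℂ) g

/-- The coefficient of `t_g`. -/
def coeff (g : G) : TwistedSkewGroupAlgebra φ α →ₗ[ℂ] A := Finsupp.lapply (M := A) (R := ℂ) g

theorem coeff_term (g h : G) (a : A) [Decidable (g = h)] :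
    coeff φ α h (term φ α g a) = if g = h then a else 0 := by
  unfold coeff term
  exact Finsupp.single_apply

variable {φ α} in
theorem ext {x y : TwistedSkewGroupAlgebra φ α} (h : ∀ g, coeff φ α g x = coeff φ α g y) : x = y :=
  Finsupp.ext (f := (x : G →₀ A)) (g := (y : G →₀ A)) h

variable {φ α} in
theorem induction {p : TwistedSkewGroupAlgebra φ α → Prop} (x : TwistedSkewGroupAlgebra φ α)
    (h0 : p 0) (hadd : ∀ x y, p x → p y → p (x + y)) (hterm : ∀ g a, p (term φ α g a)) : p x :=
  Finsupp.induction_linear (motive := p) x h0 hadd hterm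

/-- The linear map out of `A #_α G` given by a linear map on each summand `A t_g`. -/
def liftLin {M : Type*} [AddCommGroup M] [Module ℂ M] (f : G → A →ₗ[ℂ] M) :
    TwistedSkewGroupAlgebra φ α →ₗ[ℂ] M := Finsupp.lsum (M := A) (R := ℂ) ℂ f

theorem liftLin_term {M : Type*} [AddCommGroup M] [Module ℂ M] (f : G → A →ₗ[ℂ] M) (g : G)
    (a : A) : liftLin φ α f (term φ α g a) = f g a :=
  Finsupp.lsum_single ℂ f g a

/-- The product of `a t_g` and `b t_h`, bilinear in `a` and `b`:
`(a t_g)(b t_h) = α(g,h) a (g • b) t_{gh}`. -/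
def termMul (g h : G) : A →ₗ[ℂ] A →ₗ[ℂ] TwistedSkewGroupAlgebra φ α :=
  LinearMap.mk₂ ℂ (fun a b => term φ α (g * h) ((α g h : ℂ) • (a * φ g b)))
    (fun a a' b => by rw [add_mul, smul_add, map_add])
    (fun c a b => by rw [smul_mul_assoc, smul_comm, map_smul])
    (fun a b b' => by rw [map_add, mul_add, smul_add, map_add])
    (fun c a b => by rw [map_smul (φ g), mul_smul_comm, smul_comm, map_smul])

/-- The multiplication of `A #_α G`, as a bilinear map. -/
def mulLin : TwistedSkewGroupAlgebra φ α →ₗ[ℂ] TwistedSkewGroupAlgebra φ α →ₗ[ℂ]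
    TwistedSkewGroupAlgebra φ α :=
  liftLin φ α fun g => (liftLin φ α fun h => (termMul φ α g h).flip).flip

theorem mulLin_term (g h : G) (a b : A) :
    mulLin φ α (term φ α g a) (term φ α h b)
      = term φ α (g * h) ((α g h : ℂ) • (a * φ g b)) := by
  rw [mulLin, liftLin_term, LinearMap.flip_apply, liftLin_term, LinearMap.flip_apply]
  rfl

theorem mulLin_assoc (x y z : TwistedSkewGroupAlgebra φ α) :
    mulLin φ α (mulLin φ α x y) z = mulLin φ α x (mulLin φ α y z) := by
  induction x using induction with
  | h0 => simp
  | hadd x x' hx hx' => simp only [map_add, LinearMap.add_apply, hx, hx']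
  | hterm g a =>
  induction y using induction with
  | h0 => simp
  | hadd y y' hy hy' => simp only [map_add, LinearMap.add_apply, hy, hy']
  | hterm h b =>
  induction z using induction with
  | h0 => simp
  | hadd z z' hz hz' => simp only [map_add, hz, hz']
  | hterm k c =>
  have hc : (α g h : ℂ) * α (g * h) k = α h k * α g (h * k) := by
    exact_mod_cast congrArg Units.val (α.cocycle g h k)
  rw [mulLin_term, mulLin_term, mulLin_term, mulLin_term, mul_assoc g h k]
  congr 1
  rw [map_smul (φ g), map_mul (φ g), map_mul φ, AlgEquiv.mul_apply, smul_mul_assoc,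
    mul_smul_comm, smul_smul, smul_smul, mul_comm, hc, mul_assoc a, mul_comm]

instance : One (TwistedSkewGroupAlgebra φ α) := ⟨term φ α 1 1⟩

instance : Mul (TwistedSkewGroupAlgebra φ α) := ⟨fun x y => mulLin φ α x y⟩

theorem one_def : (1 : TwistedSkewGroupAlgebra φ α) = term φ α 1 1 := rfl

theorem mul_def (x y : TwistedSkewGroupAlgebra φ α) : x * y = mulLin φ α x y := rfl

theorem term_mul_term (g h : G) (a b : A) :
    term φ α g a * term φ α h b = term φ α (g * h) ((α g h : ℂ) • (a * φ g b)) :=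
  mulLin_term φ α g h a b

theorem one_mul_aux (x : TwistedSkewGroupAlgebra φ α) : 1 * x = x := by
  rw [one_def, mul_def]
  induction x using induction with
  | h0 => simp
  | hadd x x' hx hx' => rw [map_add, hx, hx']
  | hterm g a => rw [mulLin_term]; simp [α.map_one_left]

theorem mul_one_aux (x : TwistedSkewGroupAlgebra φ α) : x * 1 = x := by
  rw [one_def, mul_def]
  induction x using induction with
  | h0 => simp
  | hadd x x' hx hx' => rw [map_add, LinearMap.add_apply, hx, hx']
  | hterm g a => rw [mulLin_term]; simp [α.map_one_right]

instance : Ring (TwistedSkewGroupAlgebra φ α) :=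
  { (inferInstance : AddCommGroup (TwistedSkewGroupAlgebra φ α)) with
    mul := (· * ·)
    one := 1
    left_distrib := fun x y z => map_add (mulLin φ α x) y z
    right_distrib := fun x y z => by
      change mulLin φ α (x + y) z = mulLin φ α x z + mulLin φ α y z
      rw [map_add, LinearMap.add_apply]
    zero_mul := fun x => by
      change mulLin φ α 0 x = 0
      rw [map_zero, LinearMap.zero_apply]
    mul_zero := fun x => map_zero (mulLin φ α x)
    mul_assoc := mulLin_assoc φ α
    one_mul := one_mul_aux φ α
    mul_one := mul_one_aux φ α }

instance : Algebra ℂ (TwistedSkewGroupAlgebra φ α) :=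
  Algebra.ofModule
    (fun c x y => by
      change mulLin φ α (c • x) y = c • mulLin φ α x y
      rw [map_smul, LinearMap.smul_apply])
    (fun c x y => map_smul (mulLin φ α x) c y)

/-- For a family `𝒜` of subspaces of `A` (its homogeneous components), the subspace of `A #_α G`
of the elements all of whose coefficients lie in `𝒜 d`. When `𝒜` is a grading of `A` this is the
homogeneous component of degree `d` of `A #_α G`, group elements having degree zero. -/
def homogeneous (𝒜 : ℕ → Submodule ℂ A) (d : ℕ) : Submodule ℂ (TwistedSkewGroupAlgebra φ α) :=
  ⨅ g : G, (𝒜 d).comap (coeff φ α g)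

variable {φ α} in
theorem mem_homogeneous {𝒜 : ℕ → Submodule ℂ A} {d : ℕ} {x : TwistedSkewGroupAlgebra φ α} :
    x ∈ homogeneous φ α 𝒜 d ↔ ∀ g, coeff φ α g x ∈ 𝒜 d := by
  simp [homogeneous]

theorem term_mem_homogeneous {𝒜 : ℕ → Submodule ℂ A} {d : ℕ} (g : G) {a : A} (ha : a ∈ 𝒜 d) :
    term φ α g a ∈ homogeneous φ α 𝒜 d := by
  classical
  rw [mem_homogeneous]
  intro h
  rw [coeff_term]
  split_ifs
  exacts [ha, zero_mem _]

theorem homogeneous_eq_iSup (𝒜 : ℕ → Submodule ℂ A) (d : ℕ) :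
    homogeneous φ α 𝒜 d = ⨆ g : G, (𝒜 d).map (term φ α g) := by
  apply le_antisymm
  · intro x hx
    have hsum : x = (x : G →₀ A).sum fun g a => term φ α g a :=
      (Finsupp.sum_single (x : G →₀ A)).symm
    rw [hsum]
    exact Submodule.sum_mem _ fun g _ => Submodule.mem_iSup_of_mem g
      (Submodule.mem_map_of_mem (mem_homogeneous.1 hx g))
  · refine iSup_le fun g => ?_
    rintro _ ⟨a, ha, rfl⟩
    exact term_mem_homogeneous φ α g ha

theorem homogeneous_mul_le {𝒜 : ℕ → Submodule ℂ A} [SetLike.GradedMonoid 𝒜]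
    (hφ : ∀ g d a, a ∈ 𝒜 d → φ g a ∈ 𝒜 d) (i j : ℕ) :
    homogeneous φ α 𝒜 i * homogeneous φ α 𝒜 j ≤ homogeneous φ α 𝒜 (i + j) := by
  rw [homogeneous_eq_iSup φ α 𝒜 i, homogeneous_eq_iSup φ α 𝒜 j, Submodule.iSup_mul]
  refine iSup_le fun g => ?_
  rw [Submodule.mul_iSup]
  refine iSup_le fun h => ?_
  rw [Submodule.mul_le]
  rintro _ ⟨a, ha, rfl⟩ _ ⟨b, hb, rfl⟩
  rw [term_mul_term]
  exact term_mem_homogeneous φ α _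
    (Submodule.smul_mem _ _ (SetLike.mul_mem_graded ha (hφ g j b hb)))

end

end TwistedSkewGroupAlgebra

/-- The twisted group algebra `ℂ^α G`, i.e. `ℂ #_α G` with the trivial action. -/
abbrev TwistedGroupAlgebra {G : Type*} [Group G] (α : NormalizedTwoCocycle G) : Type _ :=
  TwistedSkewGroupAlgebra (1 : G →* (ℂ ≃ₐ[ℂ] ℂ)) α

namespace TwistedGroupAlgebra

/-- The basis element `t_g` of `ℂ^α G`. -/
def t {G : Type*} [Group G] (α : NormalizedTwoCocycle G) (g : G) : TwistedGroupAlgebra α :=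
  TwistedSkewGroupAlgebra.term 1 α g 1

/-- The inclusion `ℂ^α G → A #_α G`, `c t_g ↦ c 1_A t_g`. -/
def incl {G A : Type*} [Group G] [Ring A] [Algebra ℂ A] (φ : G →* (A ≃ₐ[ℂ] A))
    (α : NormalizedTwoCocycle G) : TwistedGroupAlgebra α →ₗ[ℂ] TwistedSkewGroupAlgebra φ α :=
  TwistedSkewGroupAlgebra.liftLin 1 α fun g =>
    (TwistedSkewGroupAlgebra.term φ α g).comp (Algebra.linearMap ℂ A)

end TwistedGroupAlgebra

/-! ### The associated graded algebra of a filtered algebra -/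

section AssociatedGraded

variable {A : Type*} [Ring A] [Algebra ℂ A]

/-- The homogeneous component `F i / F_{<i}` of the associated graded algebra. -/
def GradedPiece (F Flt : ℕ → Submodule ℂ A) (i : ℕ) : Type _ :=
  (F i) ⧸ (Flt i).submoduleOf (F i)

namespace GradedPiece

variable (F Flt : ℕ → Submodule ℂ A)

instance (i : ℕ) : AddCommGroup (GradedPiece F Flt i) :=
  inferInstanceAs (AddCommGroup ((F i) ⧸ (Flt i).submoduleOf (F i)))

instance (i : ℕ) : Module ℂ (GradedPiece F Flt i) :=
  inferInstanceAs (Module ℂ ((F i) ⧸ (Flt i).submoduleOf (F i)))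

/-- The class in `F i / F_{<i}` of an element of `F i`. -/
def mk (i : ℕ) : F i →ₗ[ℂ] GradedPiece F Flt i := ((Flt i).submoduleOf (F i)).mkQ

/-- A linear map on `F i` that vanishes on `F_{<i}` factors through `F i / F_{<i}`. -/
def lift {M : Type*} [AddCommGroup M] [Module ℂ M] (i : ℕ) (f : F i →ₗ[ℂ] M)
    (hf : ∀ a : F i, (a : A) ∈ Flt i → f a = 0) : GradedPiece F Flt i →ₗ[ℂ] M :=
  ((Flt i).submoduleOf (F i)).liftQ f fun a ha => hf a ha

theorem mk_surjective (i : ℕ) : Function.Surjective (mk F Flt i) := Submodule.mkQ_surjective _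

theorem mk_eq_mk_iff {i : ℕ} (x y : F i) :
    mk F Flt i x = mk F Flt i y ↔ (x : A) - y ∈ Flt i := by
  refine (Submodule.Quotient.eq _).trans ?_
  simp [Submodule.submoduleOf]

theorem mk_eq_of_eq {i j : ℕ} (h : i = j) (a : F i) (b : F j) (hab : (a : A) = b) :
    GradedMonoid.mk (A := GradedPiece F Flt) i (mk F Flt i a) = .mk j (mk F Flt j b) := by
  subst h
  rw [Subtype.ext hab]

variable [IsRingFiltration F Flt]

theorem mul_mem_lt_right {i j : ℕ} {a b : A} (ha : a ∈ F i) (hb : b ∈ Flt j) :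
    a * b ∈ Flt (i + j) := by
  have h : Flt j ≤ (Flt (i + j)).comap (LinearMap.mulLeft ℂ a) :=
    IsFiltration.is_sup (F := F) _ j fun k hk b hb =>
      IsFiltration.is_le (F := F) (Nat.add_lt_add_left hk i) (SetLike.mul_mem_graded ha hb)
  exact h hb

theorem mul_mem_lt_left {i j : ℕ} {a b : A} (ha : a ∈ Flt i) (hb : b ∈ F j) :
    a * b ∈ Flt (i + j) := by
  have h : Flt i ≤ (Flt (i + j)).comap (LinearMap.mulRight ℂ b) :=
    IsFiltration.is_sup (F := F) _ i fun k hk a ha =>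
      IsFiltration.is_le (F := F) (Nat.add_lt_add_right hk j) (SetLike.mul_mem_graded ha hb)
  exact h ha

/-- The product `F i × F j → F (i + j)` of elements of the filtration. -/
def mulF (i j : ℕ) : F i →ₗ[ℂ] F j →ₗ[ℂ] F (i + j) :=
  LinearMap.mk₂ ℂ (fun a b => ⟨a * b, SetLike.mul_mem_graded a.2 b.2⟩)
    (fun _ _ _ => Subtype.ext (add_mul _ _ _))
    (fun _ _ _ => Subtype.ext (smul_mul_assoc _ _ _))
    (fun _ _ _ => Subtype.ext (mul_add _ _ _))
    (fun _ _ _ => Subtype.ext (mul_smul_comm _ _ _))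

/-- The product of the associated graded algebra, induced by the product of `A`. -/
def mul (i j : ℕ) : GradedPiece F Flt i →ₗ[ℂ] GradedPiece F Flt j →ₗ[ℂ] GradedPiece F Flt (i + j) :=
  lift F Flt i
    (lift F Flt j ((mulF F Flt i j).compr₂ (mk F Flt (i + j))).flip (by
      intro b hb
      ext a
      refine (mk_eq_mk_iff F Flt _ 0).2 ?_
      rw [ZeroMemClass.coe_zero, sub_zero]
      exact mul_mem_lt_right F Flt a.2 hb)).flip
    (by
      intro a ha
      ext b
      obtain ⟨b, rfl⟩ := mk_surjective F Flt j b
      refine (mk_eq_mk_iff F Flt _ 0).2 ?_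
      rw [ZeroMemClass.coe_zero, sub_zero]
      exact mul_mem_lt_left F Flt ha b.2)

theorem mul_mk (i j : ℕ) (a : F i) (b : F j) :
    mul F Flt i j (mk F Flt i a) (mk F Flt j b)
      = mk F Flt (i + j) ⟨a * b, SetLike.mul_mem_graded a.2 b.2⟩ := rfl

instance : GradedMonoid.GOne (GradedPiece F Flt) :=
  ⟨mk F Flt 0 ⟨1, SetLike.one_mem_graded F⟩⟩

instance : GradedMonoid.GMul (GradedPiece F Flt) := ⟨fun {i j} a b => mul F Flt i j a b⟩

instance : DirectSum.GRing (GradedPiece F Flt) where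
  one := GradedMonoid.GOne.one
  mul := GradedMonoid.GMul.mul
  mul_zero a := map_zero (mul F Flt _ _ a)
  zero_mul b := by
    change mul F Flt _ _ 0 b = 0
    rw [map_zero, LinearMap.zero_apply]
  mul_add a b c := map_add (mul F Flt _ _ a) b c
  add_mul a b c := by
    change mul F Flt _ _ (a + b) c = mul F Flt _ _ a c + mul F Flt _ _ b c
    rw [map_add, LinearMap.add_apply]
  one_mul := by
    rintro ⟨i, a⟩
    obtain ⟨a, rfl⟩ := mk_surjective F Flt i a
    exact mk_eq_of_eq F Flt (zero_add i) _ _ (one_mul (a : A))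
  mul_one := by
    rintro ⟨i, a⟩
    obtain ⟨a, rfl⟩ := mk_surjective F Flt i a
    exact mk_eq_of_eq F Flt (add_zero i) _ _ (mul_one (a : A))
  mul_assoc := by
    rintro ⟨i, a⟩ ⟨j, b⟩ ⟨k, c⟩
    obtain ⟨a, rfl⟩ := mk_surjective F Flt i a
    obtain ⟨b, rfl⟩ := mk_surjective F Flt j b
    obtain ⟨c, rfl⟩ := mk_surjective F Flt k c
    exact mk_eq_of_eq F Flt (add_assoc i j k) _ _ (mul_assoc (a : A) b c)
  natCast n := n • (GradedMonoid.GOne.one : GradedPiece F Flt 0)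
  natCast_zero := zero_smul _ _
  natCast_succ n := succ_nsmul _ n
  intCast n := n • (GradedMonoid.GOne.one : GradedPiece F Flt 0)
  intCast_ofNat n := natCast_zsmul _ n
  intCast_negSucc_ofNat n := negSucc_zsmul _ n

instance : DirectSum.GAlgebra ℂ (GradedPiece F Flt) where
  toFun := (LinearMap.toSpanSingleton ℂ (GradedPiece F Flt 0)
    (GradedMonoid.GOne.one : GradedPiece F Flt 0)).toAddMonoidHom
  map_one := one_smul ℂ (GradedMonoid.GOne.one : GradedPiece F Flt 0)
  map_mul r s := by
    have h1 : ∀ c : ℂ, c • (1 : A) ∈ F 0 := fun c =>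
      Submodule.smul_mem _ _ (SetLike.one_mem_graded F)
    exact mk_eq_of_eq F Flt (add_zero 0).symm ⟨(r * s) • 1, h1 _⟩
      ⟨(r • 1) * (s • 1), SetLike.mul_mem_graded (h1 r) (h1 s)⟩ (by simp [mul_smul, smul_comm r s])
  commutes := by
    rintro r ⟨i, a⟩
    obtain ⟨a, rfl⟩ := mk_surjective F Flt i a
    exact mk_eq_of_eq F Flt ((zero_add i).trans (add_zero i).symm)
      ⟨(r • 1) * a, SetLike.mul_mem_graded
        (Submodule.smul_mem _ _ (SetLike.one_mem_graded F)) a.2⟩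
      ⟨a * (r • 1), SetLike.mul_mem_graded a.2
        (Submodule.smul_mem _ _ (SetLike.one_mem_graded F))⟩ (by simp)
  smul_def := by
    rintro r ⟨i, a⟩
    obtain ⟨a, rfl⟩ := mk_surjective F Flt i a
    exact mk_eq_of_eq F Flt (zero_add i).symm (r • a)
      ⟨(r • 1) * a, SetLike.mul_mem_graded
        (Submodule.smul_mem _ _ (SetLike.one_mem_graded F)) a.2⟩ (by simp)

end GradedPiece

/-- The associated graded algebra `⨁ i, F i / F_{<i}` of a filtered algebra. -/
abbrev AssociatedGraded (F Flt : ℕ → Submodule ℂ A) : Type _ := ⨁ i, GradedPiece F Flt i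

end AssociatedGraded

/-! ### Quantum symmetric algebras and the algebras `H_{q,κ,α}` -/

section Hecke

variable {G V : Type*} [Group G] [AddCommGroup V] [Module ℂ V] {n : ℕ}

/-- The relations `v_i v_j = q_{ij} v_j v_i` in the tensor algebra `T(V)`. -/
inductive QuantumSymmetricRel (v : Module.Basis (Fin n) ℂ V) (q : Fin n → Fin n → ℂ) :
    TensorAlgebra ℂ V → TensorAlgebra ℂ V → Prop
  | mk (i j : Fin n) : QuantumSymmetricRel v q
      (TensorAlgebra.ι ℂ (v i) * TensorAlgebra.ι ℂ (v j))
      (q i j • (TensorAlgebra.ι ℂ (v j) * TensorAlgebra.ι ℂ (v i)))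

/-- The quantum symmetric algebra `S_q(V)`. -/
abbrev QuantumSymmetricAlgebra (v : Module.Basis (Fin n) ℂ V) (q : Fin n → Fin n → ℂ) : Type _ :=
  RingQuot (QuantumSymmetricRel v q)

/-- The canonical map `V → S_q(V)`. -/
def QuantumSymmetricAlgebra.ι (v : Module.Basis (Fin n) ℂ V) (q : Fin n → Fin n → ℂ) :
    V →ₗ[ℂ] QuantumSymmetricAlgebra v q :=
  (RingQuot.mkAlgHom ℂ (QuantumSymmetricRel v q)).toLinearMap.comp (TensorAlgebra.ι ℂ)

/-- The homogeneous component of degree `d` of `S_q(V)`: the span of the products of `d` elements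
of `V`. -/
def QuantumSymmetricAlgebra.component (v : Module.Basis (Fin n) ℂ V) (q : Fin n → Fin n → ℂ)
    (d : ℕ) : Submodule ℂ (QuantumSymmetricAlgebra v q) :=
  LinearMap.range (QuantumSymmetricAlgebra.ι v q) ^ d

/-- The homogeneous component of degree `d` of the tensor algebra `T(V)`. -/
def tensorComponent (V : Type*) [AddCommGroup V] [Module ℂ V] (d : ℕ) :
    Submodule ℂ (TensorAlgebra ℂ V) :=
  LinearMap.range (TensorAlgebra.ι ℂ : V →ₗ[ℂ] TensorAlgebra ℂ V) ^ d

instance : SetLike.GradedMonoid (tensorComponent V) :=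
  Submodule.nat_power_gradedMonoid (LinearMap.range (TensorAlgebra.ι ℂ : V →ₗ[ℂ] _))

/-- The algebra endomorphism of `T(V)` extending a linear endomorphism of `V`. -/
def tensorMap (f : V →ₗ[ℂ] V) : TensorAlgebra ℂ V →ₐ[ℂ] TensorAlgebra ℂ V :=
  TensorAlgebra.lift ℂ ((TensorAlgebra.ι ℂ).comp f)

theorem tensorMap_ι (f : V →ₗ[ℂ] V) (x : V) :
    tensorMap f (TensorAlgebra.ι ℂ x) = TensorAlgebra.ι ℂ (f x) := by
  simp [tensorMap]

theorem tensorMap_mul (f f' : V →ₗ[ℂ] V) :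
    tensorMap (f * f') = (tensorMap f).comp (tensorMap f') := by
  ext x
  simp [tensorMap_ι]

theorem tensorMap_one : tensorMap (1 : V →ₗ[ℂ] V) = AlgHom.id ℂ _ := by
  ext x
  simp [tensorMap_ι]

/-- The action of `G` on `T(V)` by algebra automorphisms extending a linear action on `V`. -/
def tensorAction (ρ : Representation ℂ G V) :
    G →* (TensorAlgebra ℂ V ≃ₐ[ℂ] TensorAlgebra ℂ V) where
  toFun g := AlgEquiv.ofAlgHom (tensorMap (ρ g)) (tensorMap (ρ g⁻¹))
    (by rw [← tensorMap_mul, ← map_mul, mul_inv_cancel, map_one, tensorMap_one])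
    (by rw [← tensorMap_mul, ← map_mul, inv_mul_cancel, map_one, tensorMap_one])
  map_one' := by
    ext x
    simp [tensorMap_one]
  map_mul' g h := by
    ext x
    simp [tensorMap_mul]

theorem tensorAction_mem (ρ : Representation ℂ G V) (g : G) (d : ℕ) (a : TensorAlgebra ℂ V)
    (ha : a ∈ tensorComponent V d) : tensorAction ρ g a ∈ tensorComponent V d := by
  have h : (tensorComponent V d).map (tensorMap (ρ g)).toLinearMap ≤ tensorComponent V d := by
    unfold tensorComponent
    rw [Submodule.map_pow]
    refine pow_le_pow_left' ?_ d
    rintro _ ⟨_, ⟨x, rfl⟩, rfl⟩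
    exact ⟨ρ g x, (tensorMap_ι (ρ g) x).symm⟩
  exact h (Submodule.mem_map_of_mem ha)

/-- The algebra `T(V) #_α G`. -/
abbrev TwistedTensor (ρ : Representation ℂ G V) (α : NormalizedTwoCocycle G) : Type _ :=
  TwistedSkewGroupAlgebra (tensorAction ρ) α

variable (v : Module.Basis (Fin n) ℂ V) (ρ : Representation ℂ G V) (q : Fin n → Fin n → ℂ)
  (α : NormalizedTwoCocycle G) (κ : V →ₗ[ℂ] V →ₗ[ℂ] TwistedGroupAlgebra α)

/-- The relations `v_i v_j = q_{ij} v_j v_i + κ(v_i, v_j)` in `T(V) #_α G`. -/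
inductive QuantumHeckeRel : TwistedTensor ρ α → TwistedTensor ρ α → Prop
  | mk (i j : Fin n) : QuantumHeckeRel
      (TwistedSkewGroupAlgebra.term (tensorAction ρ) α 1
        (TensorAlgebra.ι ℂ (v i) * TensorAlgebra.ι ℂ (v j)))
      (q i j • TwistedSkewGroupAlgebra.term (tensorAction ρ) α 1
          (TensorAlgebra.ι ℂ (v j) * TensorAlgebra.ι ℂ (v i))
        + TwistedGroupAlgebra.incl (tensorAction ρ) α (κ (v i) (v j)))

/-- The algebra `H_{q,κ,α}`. -/
abbrev QuantumHecke : Type _ := RingQuot (QuantumHeckeRel v ρ q α κ)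

/-- The filtration of `H_{q,κ,α}`, where each `v_i` has degree one and each group element has degree
zero: `F d` is the image of the elements of `T(V) #_α G` of degree at most `d`. -/
def QuantumHecke.filtration (d : ℕ) : Submodule ℂ (QuantumHecke v ρ q α κ) :=
  (⨆ k ≤ d, TwistedSkewGroupAlgebra.homogeneous (tensorAction ρ) α (tensorComponent V) k).map
    (RingQuot.mkAlgHom ℂ (QuantumHeckeRel v ρ q α κ)).toLinearMap

/-- The union `F_{<d}` of the smaller steps of the filtration. -/
def QuantumHecke.filtrationLT (d : ℕ) : Submodule ℂ (QuantumHecke v ρ q α κ) :=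
  ⨆ k < d, QuantumHecke.filtration v ρ q α κ k

instance : IsRingFiltration (QuantumHecke.filtration v ρ q α κ)
    (QuantumHecke.filtrationLT v ρ q α κ) where
  mono := fun _ _ hij => Submodule.map_mono (iSup₂_le fun k hk =>
    le_iSup₂_of_le k (hk.trans hij) le_rfl)
  is_le := fun {i j} hij => le_iSup₂_of_le (f := fun k (_ : k < j) =>
    QuantumHecke.filtration v ρ q α κ k) i hij le_rfl
  is_sup := fun _ _ h => iSup₂_le h
  one_mem := by
    refine ⟨1, ?_, map_one (RingQuot.mkAlgHom ℂ (QuantumHeckeRel v ρ q α κ))⟩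
    refine Submodule.mem_iSup_of_mem 0 (Submodule.mem_iSup_of_mem le_rfl ?_)
    exact TwistedSkewGroupAlgebra.term_mem_homogeneous _ _ 1
      (SetLike.one_mem_graded (tensorComponent V))
  mul_mem := by
    rintro i j _ _ ⟨x, hx, rfl⟩ ⟨y, hy, rfl⟩
    refine ⟨x * y, ?_, map_mul (RingQuot.mkAlgHom ℂ (QuantumHeckeRel v ρ q α κ)) x y⟩
    have hxy := Submodule.mul_mem_mul hx hy
    revert hxy
    generalize x * y = z
    apply SetLike.le_def.1
    simp only [Submodule.iSup_mul, Submodule.mul_iSup]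
    refine iSup₂_le fun k hk => iSup₂_le fun l hl => ?_
    exact (TwistedSkewGroupAlgebra.homogeneous_mul_le _ _ (tensorAction_mem ρ) _ _).trans
      (le_iSup₂_of_le (f := fun m (_ : m ≤ i + j) =>
        TwistedSkewGroupAlgebra.homogeneous (tensorAction ρ) α (tensorComponent V) m)
        _ (by omega) le_rfl)

/-- `H_{q,κ,α}` is a twisted quantum Drinfeld Hecke algebra: the action of `G` on `V` induces an
action `φ` of `G` on `S_q(V)` by algebra automorphisms (necessarily unique), and the associated
graded algebra of `H_{q,κ,α}` is isomorphic, as a graded algebra, to `S_q(V) #_α G`. -/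
def IsTwistedQuantumDrinfeldHecke : Prop :=
  ∃ φ : G →* (QuantumSymmetricAlgebra v q ≃ₐ[ℂ] QuantumSymmetricAlgebra v q),
    (∀ g x, φ g (QuantumSymmetricAlgebra.ι v q x) = QuantumSymmetricAlgebra.ι v q (ρ g x)) ∧
    ∃ e : AssociatedGraded (QuantumHecke.filtration v ρ q α κ) (QuantumHecke.filtrationLT v ρ q α κ)
        ≃ₐ[ℂ] TwistedSkewGroupAlgebra φ α,
      ∀ d : ℕ,
        (LinearMap.range (DirectSum.lof ℂ ℕ (GradedPiece (QuantumHecke.filtration v ρ q α κ)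
          (QuantumHecke.filtrationLT v ρ q α κ)) d)).map e.toLinearMap
        = TwistedSkewGroupAlgebra.homogeneous φ α (QuantumSymmetricAlgebra.component v q) d

/-- The parameter space: the bilinear maps `κ : V × V → ℂ^α G` with
`κ(v_i, v_j) = -q_{ij} κ(v_j, v_i)` for which `H_{q,κ,α}` is a twisted quantum Drinfeld Hecke
algebra. -/
def parameterSpace : Set (V →ₗ[ℂ] V →ₗ[ℂ] TwistedGroupAlgebra α) :=
  {κ | (∀ i j, κ (v i) (v j) = -(q i j • κ (v j) (v i))) ∧
    IsTwistedQuantumDrinfeldHecke v ρ q α κ}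

variable (lam : G → Fin n → ℂ)

/-- The conditions on a triple `(r, s, a)`, for the eigenvalues `lam g i = λ_{g,i}`. -/
def IsAdmissible (r s : Fin n) (a : G) : Prop :=
  r < s ∧ (∀ r' : Fin n, r' ≠ r → r' ≠ s → q r r' * q s r' = lam a r') ∧
    ∀ h ∈ Subgroup.centralizer {a}, lam h r * lam h s = (α h a : ℂ) / α a h

/-- The bilinear map `f_{r,s,a}`, with `T` a set of representatives of the left cosets of the
centralizer of `a`. -/
def basisMap (T : Finset G) (r s : Fin n) (a : G) : V →ₗ[ℂ] V →ₗ[ℂ] TwistedGroupAlgebra α :=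
  v.constr ℂ fun i => v.constr ℂ fun j =>
    ((if i = r then 1 else 0) * (if j = s then 1 else 0)
        - q s r * (if i = s then 1 else 0) * (if j = r then 1 else 0) : ℂ) •
      ∑ g ∈ T, ((α g a : ℂ) / α (g * a * g⁻¹) g * (lam g r)⁻¹ * (lam g s)⁻¹) •
        TwistedGroupAlgebra.t α (g * a * g⁻¹)

end Hecke

end

/-!
The algebra `H_{q,κ,α}` is a twisted quantum Drinfeld Hecke algebra if and only if the coefficients
of `κ` satisfy the linear conditions `HeckeConditions`: quantum antisymmetry, invariance under `G`,
and the quantum Jacobi identity, which says that `λ_{g,l} = q_{il} q_{jl}` for `l ∉ {i, j}` whenever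
`t_g` occurs in `κ(v_i, v_j)` (`QuantumHecke.mem_parameterSpace_iff`).

*Necessity* (`QuantumHecke.conditions_of_isTwistedQuantumDrinfeldHecke`). A graded isomorphism with
`S_q(V) #_α G`, whatever it is, fixes the dimensions of the first two components of the associated
graded algebra, so the elements `t_g` and `v_i t_g`, which span the first two steps of the
filtration, are linearly independent. The conditions are then read off by writing `t_h v_i v_j` and
`v_i v_j v_l` in two ways.

*Sufficiency* (`QuantumHecke.isTwistedQuantumDrinfeldHecke_of_conditions`). There is always a
surjective symbol map from `S_q(V) #_α G` to the associated graded algebra. It is injective once the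
ordered monomials `v_0 ^ m_0 ⋯ v_{n-1} ^ m_{n-1} t_g` are linearly independent in `H_{q,κ,α}`.
This is shown by exhibiting the algebra as an iterated Ore extension of the twisted group algebra:
the conditions ensure that `v_n b = σ(b) v_n + δ(b)` for an endomorphism `σ` and a `σ`-derivation
`δ` of the algebra on the previous variables (`QuantumPresentation.satisfies_matrix`), so that the
algebra with one more variable acts on the free module with basis the powers of `v_n`
(`QuantumPresentation.linearIndependent_monomials`).

Finally, a `κ` satisfying the conditions is determined by its coefficients `κ_a(v_r, v_s)` at the
admissible triples: invariance reduces to representatives `a` of the conjugacy classes,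
antisymmetry to `r < s`, and the conditions force `(r, s, a)` to be admissible when the coefficient
is nonzero (`bracketCoeff_eq_zero`). The maps `f_{r,s,a}` satisfy the conditions and are dual to
these coordinates (`basisMap_mem_conditionSubmodule`, `bracketCoeff_basisMap_eq_ite`).
-/

open scoped DirectSum

noncomputable section

/-! ### Algebra homomorphisms out of a twisted skew group algebra -/

namespace TwistedSkewGroupAlgebra

variable {G A B : Type*} [Group G] [Ring A] [Algebra ℂ A] [Ring B] [Algebra ℂ B]
  (φ : G →* (A ≃ₐ[ℂ] A)) (α : NormalizedTwoCocycle G)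

/-- The inclusion of `A` into `A #_α G`. -/
def inclusion : A →ₐ[ℂ] TwistedSkewGroupAlgebra φ α :=
  AlgHom.ofLinearMap (term φ α 1) rfl fun a b => by
    rw [term_mul_term]
    simp [α.map_one_left]

theorem inclusion_apply (a : A) : inclusion φ α a = term φ α 1 a := rfl

theorem inclusion_mul_term (g : G) (a : A) :
    inclusion φ α a * term φ α g 1 = term φ α g a := by
  rw [inclusion_apply, term_mul_term]
  simp [α.map_one_left]

theorem term_mul_inclusion (g : G) (a : A) :
    term φ α g 1 * inclusion φ α a = term φ α g (φ g a) := by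
  rw [inclusion_apply, term_mul_term]
  simp [α.map_one_right]

theorem term_one_mul_term_one (g h : G) :
    term φ α g 1 * term φ α h 1 = (α g h : ℂ) • term φ α (g * h) 1 := by
  rw [term_mul_term]
  simp

/-- The universal property of `A #_α G`: an algebra homomorphism `f` out of `A` together with
elements `τ g` multiplying like the `t_g` and intertwining the action extends to `A #_α G`. -/
def liftHom (f : A →ₐ[ℂ] B) (τ : G → B) (h1 : τ 1 = 1)
    (hmul : ∀ g h, τ g * τ h = (α g h : ℂ) • τ (g * h))
    (hcomm : ∀ g a, τ g * f a = f (φ g a) * τ g) : TwistedSkewGroupAlgebra φ α →ₐ[ℂ] B :=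
  AlgHom.ofLinearMap
    (liftLin φ α fun g => (LinearMap.mulRight ℂ (τ g)).comp f.toLinearMap)
    (by rw [one_def, liftLin_term]; simp [h1])
    (fun x y => by
      induction x using induction with
      | h0 => simp
      | hadd x x' hx hx' => simp only [map_add, add_mul, hx, hx']
      | hterm g a =>
      induction y using induction with
      | h0 => simp
      | hadd y y' hy hy' => simp only [map_add, mul_add, hy, hy']
      | hterm h b =>
      rw [term_mul_term, liftLin_term, liftLin_term, liftLin_term]
      simp only [LinearMap.comp_apply, LinearMap.mulRight_apply, AlgHom.toLinearMap_apply,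
        map_smul, map_mul]
      rw [mul_assoc (f a) (τ g), ← mul_assoc (τ g), hcomm, mul_assoc _ (τ g), hmul]
      simp [mul_assoc])

theorem liftHom_term (f : A →ₐ[ℂ] B) (τ : G → B) (h1 : τ 1 = 1)
    (hmul : ∀ g h, τ g * τ h = (α g h : ℂ) • τ (g * h))
    (hcomm : ∀ g a, τ g * f a = f (φ g a) * τ g) (g : G) (a : A) :
    liftHom φ α f τ h1 hmul hcomm (term φ α g a) = f a * τ g :=
  liftLin_term φ α _ g a

/-- If `a i` is linearly independent in `A`, then so are the `a i t_g` in `A #_α G`. -/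
theorem linearIndependent_term {ι : Type*} {a : ι → A} (ha : LinearIndependent ℂ a) :
    LinearIndependent ℂ fun p : Σ _ : G, ι => term φ α p.1 (a p.2) :=
  Finsupp.linearIndependent_single (fun (_ : G) => a) fun _ => ha

end TwistedSkewGroupAlgebra

/-! ### Presentation by generators and relations, and Ore extensions -/

namespace QuantumPresentation

/-- The parameters of the presentation: the quantum scalars `q i j`, the eigenvalues
`lam g i`, and the coefficients `k i j g` of `t_g` in `κ(v_i, v_j)`, subject to the conditions under
which the ordered monomials will be linearly independent. -/
structure Parameters (G : Type*) [Group G] (α : NormalizedTwoCocycle G) (n : ℕ) where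
  q : Fin n → Fin n → ℂ
  lam : G → Fin n → ℂ
  k : Fin n → Fin n → G → ℂ
  q_diag : ∀ i, q i i = 1
  q_mul : ∀ i j, q i j * q j i = 1
  lam_ne : ∀ g i, lam g i ≠ 0
  lam_one : ∀ i, lam 1 i = 1
  lam_mul : ∀ g h i, lam (g * h) i = lam g i * lam h i
  k_diag : ∀ i g, k i i g = 0
  k_swap : ∀ i j g, k i j g = -(q i j * k j i g)
  lam_eq : ∀ i j l g, i ≠ j → l ≠ i → l ≠ j → k i j g ≠ 0 → lam g l = q i l * q j l
  k_conj : ∀ i j h a, lam h i * lam h j * k i j (h * a * h⁻¹) * α (h * a * h⁻¹) h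
    = α h a * k i j a

variable {G : Type*} [Group G] {α : NormalizedTwoCocycle G} {n : ℕ}

/-- Forgetting the last variable. -/
def Parameters.init (D : Parameters G α (n + 1)) : Parameters G α n where
  q i j := D.q i.castSucc j.castSucc
  lam g i := D.lam g i.castSucc
  k i j := D.k i.castSucc j.castSucc
  q_diag _ := D.q_diag _
  q_mul _ _ := D.q_mul _ _
  lam_ne _ _ := D.lam_ne _ _
  lam_one _ := D.lam_one _
  lam_mul _ _ _ := D.lam_mul _ _ _
  k_diag _ _ := D.k_diag _ _
  k_swap _ _ _ := D.k_swap _ _ _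
  lam_eq _ _ _ g h1 h2 h3 := D.lam_eq _ _ _ g
    ((Fin.castSucc_injective n).ne h1) ((Fin.castSucc_injective n).ne h2)
    ((Fin.castSucc_injective n).ne h3)
  k_conj _ _ _ _ := D.k_conj _ _ _ _

variable [Fintype G]

/-- The defining relations in terms of variables `v_i` and group elements `t_g`. -/
structure Satisfies (D : Parameters G α n) {B : Type*} [Semiring B] [Algebra ℂ B]
    (w : Fin n → B) (τ : G → B) : Prop where
  one : τ 1 = 1
  mul : ∀ g h, τ g * τ h = (α g h : ℂ) • τ (g * h)
  comm : ∀ g i, τ g * w i = D.lam g i • (w i * τ g)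
  quad : ∀ i j, w i * w j = D.q i j • (w j * w i) + ∑ g, D.k i j g • τ g

/-- The defining relations, as a relation on the free algebra. -/
inductive Rel (D : Parameters G α n) :
    FreeAlgebra ℂ (Fin n ⊕ G) → FreeAlgebra ℂ (Fin n ⊕ G) → Prop
  | one : Rel D (FreeAlgebra.ι ℂ (.inr 1)) 1
  | mul (g h : G) : Rel D (FreeAlgebra.ι ℂ (.inr g) * FreeAlgebra.ι ℂ (.inr h))
      ((α g h : ℂ) • FreeAlgebra.ι ℂ (.inr (g * h)))
  | comm (g : G) (i : Fin n) : Rel D (FreeAlgebra.ι ℂ (.inr g) * FreeAlgebra.ι ℂ (.inl i))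
      (D.lam g i • (FreeAlgebra.ι ℂ (.inl i) * FreeAlgebra.ι ℂ (.inr g)))
  | quad (i j : Fin n) : Rel D (FreeAlgebra.ι ℂ (.inl i) * FreeAlgebra.ι ℂ (.inl j))
      (D.q i j • (FreeAlgebra.ι ℂ (.inl j) * FreeAlgebra.ι ℂ (.inl i))
        + ∑ g, D.k i j g • FreeAlgebra.ι ℂ (.inr g))

/-- The algebra with generators `v_i`, `t_g` and the relations `Satisfies`. -/
abbrev Pres (D : Parameters G α n) : Type _ := RingQuot (Rel D)

/-- The generator `v_i`. -/
def gen (D : Parameters G α n) (i : Fin n) : Pres D :=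
  RingQuot.mkAlgHom ℂ (Rel D) (FreeAlgebra.ι ℂ (.inl i))

/-- The generator `t_g`. -/
def grp (D : Parameters G α n) (g : G) : Pres D :=
  RingQuot.mkAlgHom ℂ (Rel D) (FreeAlgebra.ι ℂ (.inr g))

theorem satisfies_pres (D : Parameters G α n) : Satisfies D (gen D) (grp D) where
  one := by simpa [grp] using RingQuot.mkAlgHom_rel ℂ (Rel.one (D := D))
  mul g h := by simpa [grp] using RingQuot.mkAlgHom_rel ℂ (Rel.mul (D := D) g h)
  comm g i := by simpa [grp, gen] using RingQuot.mkAlgHom_rel ℂ (Rel.comm (D := D) g i)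
  quad i j := by simpa [grp, gen] using RingQuot.mkAlgHom_rel ℂ (Rel.quad (D := D) i j)

section

variable {B : Type*} [Semiring B] [Algebra ℂ B]

theorem Satisfies.map {C : Type*} [Semiring C] [Algebra ℂ C] {D : Parameters G α n} {w : Fin n → B}
    {τ : G → B} (h : Satisfies D w τ) (f : B →ₐ[ℂ] C) :
    Satisfies D (fun i => f (w i)) (fun g => f (τ g)) where
  one := by simp [h.one]
  mul g g' := by simp [← map_mul, h.mul]
  comm g i := by simp [← map_mul, h.comm]
  quad i j := by rw [← map_mul, h.quad]; simp

/-- The universal property of the presented algebra. -/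
def lift {D : Parameters G α n} {w : Fin n → B} {τ : G → B} (h : Satisfies D w τ) :
    Pres D →ₐ[ℂ] B :=
  RingQuot.liftAlgHom ℂ ⟨FreeAlgebra.lift ℂ (Sum.elim w τ), fun x y hxy => by
    cases hxy with
    | one => simpa using h.one
    | mul g g' => simpa using h.mul g g'
    | comm g i => simpa using h.comm g i
    | quad i j => simpa using h.quad i j⟩

theorem lift_gen {D : Parameters G α n} {w : Fin n → B} {τ : G → B} (h : Satisfies D w τ)
    (i : Fin n) : lift h (gen D i) = w i := by
  simp [lift, gen]

theorem lift_grp {D : Parameters G α n} {w : Fin n → B} {τ : G → B} (h : Satisfies D w τ)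
    (g : G) : lift h (grp D g) = τ g := by
  simp [lift, grp]

theorem pres_induction {D : Parameters G α n} {p : Pres D → Prop}
    (hscalar : ∀ c : ℂ, p (algebraMap ℂ _ c)) (hgen : ∀ i, p (gen D i)) (hgrp : ∀ g, p (grp D g))
    (hmul : ∀ x y, p x → p y → p (x * y)) (hadd : ∀ x y, p x → p y → p (x + y)) (x : Pres D) :
    p x := by
  obtain ⟨x, rfl⟩ := RingQuot.mkAlgHom_surjective ℂ (Rel D) x
  induction x using FreeAlgebra.induction with
  | grade0 c => simpa using hscalar c
  | grade1 x =>
    cases x with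
    | inl i => exact hgen i
    | inr g => exact hgrp g
  | mul x y hx hy => simpa using hmul _ _ hx hy
  | add x y hx hy => simpa using hadd _ _ hx hy

/-- If `λ_{g,i} = c` for all `g` in the support of `f`, then the combination `∑ f(g) t_g` commutes
with `v_i` up to the factor `c`. -/
theorem Satisfies.sum_mul_gen {D : Parameters G α n} {w : Fin n → B} {τ : G → B}
    (h : Satisfies D w τ) {f : G → ℂ} {i : Fin n} {c : ℂ} (hc : ∀ g, f g ≠ 0 → D.lam g i = c) :
    (∑ g, f g • τ g) * w i = c • (w i * ∑ g, f g • τ g) := by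
  rw [Finset.sum_mul, Finset.mul_sum, Finset.smul_sum]
  refine Finset.sum_congr rfl fun g _ => ?_
  rw [smul_mul_assoc, h.comm, mul_smul_comm, smul_comm]
  by_cases hg : f g = 0
  · simp [hg]
  · rw [hc g hg, smul_comm]

/-- The invariance condition on `κ` says that `t_h κ(v_i,v_j) = κ(h v_i, h v_j) t_h`. The bracket
may come from parameters `E` with more variables than the algebra at hand. -/
theorem Satisfies.grp_mul_sum {m : ℕ} {E : Parameters G α m} {D : Parameters G α n}
    {w : Fin n → B} {τ : G → B} (h : Satisfies D w τ) (i j : Fin m) (g : G) :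
    τ g * ∑ a, E.k i j a • τ a = (E.lam g i * E.lam g j) • ((∑ a, E.k i j a • τ a) * τ g) := by
  rw [Finset.sum_mul, Finset.mul_sum, Finset.smul_sum]
  refine Fintype.sum_equiv (MulAut.conj g).toEquiv _ _ fun a => ?_
  simp only [MulEquiv.toEquiv_eq_coe, MulEquiv.coe_toEquiv, MulAut.conj_apply]
  rw [mul_smul_comm, smul_mul_assoc, h.mul, h.mul, smul_smul, smul_smul, smul_smul,
    inv_mul_cancel_right, mul_comm _ (α g a : ℂ), ← E.k_conj i j g a]

end

/-! ### The skew derivation adjoining the last variable -/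

variable (D : Parameters G α (n + 1))

/-- The value of `κ(v_n, v_i)`, for the last variable `v_n`, in the algebra on the previous
variables. -/
def lastBracket (i : Fin n) : Pres D.init := ∑ g, D.k (Fin.last n) i.castSucc g • grp D.init g

theorem lastBracket_mul_gen {i j : Fin n} (hij : j ≠ i) :
    lastBracket D i * gen D.init j
      = (D.q (Fin.last n) j.castSucc * D.q i.castSucc j.castSucc) •
        (gen D.init j * lastBracket D i) :=
  (satisfies_pres D.init).sum_mul_gen fun g hg =>
    D.lam_eq (Fin.last n) i.castSucc j.castSucc g (Fin.castSucc_ne_last _).symm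
      (Fin.castSucc_ne_last _) ((Fin.castSucc_injective n).ne hij) hg

open Matrix in
/-- The matrices `[σ(b), δ(b); 0, b]` of the generators `b`, where the endomorphism `σ` and the
`σ`-derivation `δ` describe the commutation with the last variable `v_n`:
`v_n b = σ(b) v_n + δ(b)`. The product of such matrices encodes that `σ` is multiplicative and `δ`
is a `σ`-derivation. -/
theorem satisfies_matrix : Satisfies D.init
    (fun i => (!![D.q (Fin.last n) i.castSucc • gen D.init i, lastBracket D i; 0, gen D.init i] :
      Matrix (Fin 2) (Fin 2) (Pres D.init)))
    (fun g => !![(D.lam g (Fin.last n))⁻¹ • grp D.init g, 0; 0, grp D.init g]) where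
  one := by
    simp [D.lam_one, (satisfies_pres D.init).one, Matrix.one_fin_two]
  mul g h := by
    have := (satisfies_pres D.init).mul g h
    simp only [Matrix.mul_fin_two, Matrix.smul_of, Matrix.smul_cons, Matrix.smul_empty, smul_zero,
      mul_zero, zero_mul, add_zero, zero_add, smul_mul_assoc, mul_smul_comm, this, D.lam_mul,
      mul_inv, smul_smul]
    rw [mul_comm (D.lam h _)⁻¹, mul_comm _ (α g h : ℂ), mul_assoc]
  comm g i := by
    have h1 : grp D.init g * gen D.init i = D.lam g i.castSucc • (gen D.init i * grp D.init g) :=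
      (satisfies_pres D.init).comm g i
    have h2 : grp D.init g * lastBracket D i =
      (D.lam g (Fin.last n) * D.lam g i.castSucc) • (lastBracket D i * grp D.init g) :=
      (satisfies_pres D.init).grp_mul_sum (E := D) (Fin.last n) i.castSucc g
    have h3 : D.init.lam g i = D.lam g i.castSucc := rfl
    simp only [Matrix.mul_fin_two, Matrix.smul_of, Matrix.smul_cons, Matrix.smul_empty, smul_zero,
      mul_zero, zero_mul, add_zero, zero_add, smul_mul_assoc, mul_smul_comm, h1, h2, h3,
      smul_smul]
    rw [inv_mul_cancel_left₀ (D.lam_ne g (Fin.last n)),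
      mul_left_comm (D.lam g i.castSucc), mul_comm (D.lam g i.castSucc),
      mul_left_comm (D.lam g (Fin.last n))⁻¹]
  quad i j := by
    have h1 : gen D.init i * gen D.init j
        = D.q i.castSucc j.castSucc • (gen D.init j * gen D.init i)
          + ∑ g, D.k i.castSucc j.castSucc g • grp D.init g := (satisfies_pres D.init).quad i j
    have hinit : D.init.q i j = D.q i.castSucc j.castSucc ∧
      D.init.k i j = D.k i.castSucc j.castSucc := ⟨rfl, rfl⟩
    -- `σ` scales the bracket of two of the previous variables as it scales their product
    have h2 : ∑ g, D.k i.castSucc j.castSucc g • (D.lam g (Fin.last n))⁻¹ • grp D.init g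
        = (D.q (Fin.last n) i.castSucc * D.q (Fin.last n) j.castSucc) •
          ∑ g, D.k i.castSucc j.castSucc g • grp D.init g := by
      rw [Finset.smul_sum]
      refine Finset.sum_congr rfl fun g _ => ?_
      by_cases hk : D.k i.castSucc j.castSucc g = 0
      · simp [hk]
      have hij : i.castSucc ≠ j.castSucc := fun h => hk (by rw [h, D.k_diag])
      rw [D.lam_eq _ _ _ g hij (Fin.castSucc_ne_last _).symm (Fin.castSucc_ne_last _).symm hk,
        smul_comm, mul_inv, ← eq_inv_of_mul_eq_one_left (D.q_mul (Fin.last n) i.castSucc),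
        ← eq_inv_of_mul_eq_one_left (D.q_mul (Fin.last n) j.castSucc)]
    -- `δ` respects the commutation relation of two of the previous variables
    have h3 : D.q (Fin.last n) i.castSucc • (gen D.init i * lastBracket D j)
          + lastBracket D i * gen D.init j
        = D.q i.castSucc j.castSucc •
          (D.q (Fin.last n) j.castSucc • (gen D.init j * lastBracket D i)
            + lastBracket D j * gen D.init i) := by
      by_cases hij : i = j
      · subst hij
        rw [D.q_diag, one_smul]
      · rw [lastBracket_mul_gen D hij, lastBracket_mul_gen D (Ne.symm hij), smul_add, smul_smul,
          smul_smul, mul_left_comm, D.q_mul, mul_one, add_comm,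
          mul_comm (D.q (Fin.last n) j.castSucc)]
    have h4 : ∑ g, D.init.k i j g •
          (!![(D.lam g (Fin.last n))⁻¹ • grp D.init g, 0; 0, grp D.init g] :
            Matrix (Fin 2) (Fin 2) (Pres D.init))
        = !![∑ g, D.k i.castSucc j.castSucc g • (D.lam g (Fin.last n))⁻¹ • grp D.init g, 0;
            0, ∑ g, D.k i.castSucc j.castSucc g • grp D.init g] := by
      ext a b
      rw [Matrix.sum_apply]
      fin_cases a <;> fin_cases b <;> simp [hinit.2]
    rw [h4, h2, hinit.1]
    ext a b
    fin_cases a <;> fin_cases b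
    · simp [h1, smul_smul, mul_comm, mul_left_comm]
    · simpa using h3
    · simp
    · simp [h1]

/-- The algebra homomorphism `b ↦ [σ(b), δ(b); 0, b]`. -/
def skewMatrix : Pres D.init →ₐ[ℂ] Matrix (Fin 2) (Fin 2) (Pres D.init) :=
  lift (satisfies_matrix D)

theorem skewMatrix_apply_one (b : Pres D.init) :
    skewMatrix D b 1 0 = 0 ∧ skewMatrix D b 1 1 = b := by
  induction b using pres_induction with
  | hscalar c => simp [AlgHom.commutes, Matrix.algebraMap_matrix_apply]
  | hgen i => simp [skewMatrix, lift_gen]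
  | hgrp g => simp [skewMatrix, lift_grp]
  | hmul x y hx hy => simp [Matrix.mul_apply, hx, hy]
  | hadd x y hx hy => simp [hx, hy]

/-- The endomorphism `σ` of the Ore extension by the last variable. -/
def skewAut : Pres D.init →ₗ[ℂ] Pres D.init :=
  (Matrix.entryLinearMap ℂ _ 0 0).comp (skewMatrix D).toLinearMap

/-- The `σ`-derivation `δ` of the Ore extension by the last variable. -/
def skewDer : Pres D.init →ₗ[ℂ] Pres D.init :=
  (Matrix.entryLinearMap ℂ _ 0 1).comp (skewMatrix D).toLinearMap

theorem skewAut_mul (a b : Pres D.init) : skewAut D (a * b) = skewAut D a * skewAut D b := by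
  simp [skewAut, Matrix.mul_apply, skewMatrix_apply_one]

theorem skewDer_mul (a b : Pres D.init) :
    skewDer D (a * b) = skewAut D a * skewDer D b + skewDer D a * b := by
  simp [skewAut, skewDer, Matrix.mul_apply, skewMatrix_apply_one]

theorem skewAut_gen (i : Fin n) :
    skewAut D (gen D.init i) = D.q (Fin.last n) i.castSucc • gen D.init i := by
  simp [skewAut, skewMatrix, lift_gen]

theorem skewDer_gen (i : Fin n) : skewDer D (gen D.init i) = lastBracket D i := by
  simp [skewDer, skewMatrix, lift_gen]

theorem skewAut_grp (g : G) :
    skewAut D (grp D.init g) = (D.lam g (Fin.last n))⁻¹ • grp D.init g := by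
  simp [skewAut, skewMatrix, lift_grp]

theorem skewDer_grp (g : G) : skewDer D (grp D.init g) = 0 := by
  simp [skewDer, skewMatrix, lift_grp]

/-! ### The Ore extension as a module, and linear independence of ordered monomials -/

/-- Left multiplication by the last variable on the free module with basis its powers:
`v_n · b v_n ^ j = σ(b) v_n ^ (j + 1) + δ(b) v_n ^ j`. -/
def mulLast : Module.End ℂ (ℕ →₀ Pres D.init) :=
  Finsupp.lsum ℂ fun j =>
    (Finsupp.lsingle (j + 1)).comp (skewAut D) + (Finsupp.lsingle j).comp (skewDer D)

theorem mulLast_single (j : ℕ) (b : Pres D.init) :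
    mulLast D (Finsupp.single j b)
      = Finsupp.single (j + 1) (skewAut D b) + Finsupp.single j (skewDer D b) := by
  simp [mulLast]

/-- Left multiplication by an element of the base algebra. -/
def mulBase : Pres D.init →ₐ[ℂ] Module.End ℂ (ℕ →₀ Pres D.init) :=
  Algebra.lsmul ℂ ℂ (ℕ →₀ Pres D.init)

theorem mulBase_single (b : Pres D.init) (j : ℕ) (c : Pres D.init) :
    mulBase D b (Finsupp.single j c) = Finsupp.single j (b * c) := by
  simp [mulBase]

theorem mulLast_mul_mulBase (b : Pres D.init) :
    mulLast D * mulBase D b = mulBase D (skewAut D b) * mulLast D + mulBase D (skewDer D b) := by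
  refine Finsupp.lhom_ext fun j c => ?_
  simp only [Module.End.mul_apply, LinearMap.add_apply, mulBase_single, mulLast_single, map_add,
    skewAut_mul, skewDer_mul, Finsupp.single_add]
  abel

/-- The operators on the free module over the base algebra satisfy the relations of the algebra
with one more variable. -/
theorem satisfies_operators : Satisfies D
    (Fin.lastCases (mulLast D) fun i => mulBase D (gen D.init i) :
      Fin (n + 1) → Module.End ℂ (ℕ →₀ Pres D.init))
    (fun g => mulBase D (grp D.init g)) := by
  have base := (satisfies_pres D.init).map (mulBase D)
  have hbr : ∀ i, mulBase D (lastBracket D i)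
      = ∑ g, D.k (Fin.last n) i.castSucc g • mulBase D (grp D.init g) := fun i => by
    simp [lastBracket]
  have hlast : ∀ i : Fin n, mulLast D * mulBase D (gen D.init i)
      = D.q (Fin.last n) i.castSucc • (mulBase D (gen D.init i) * mulLast D)
        + ∑ g, D.k (Fin.last n) i.castSucc g • mulBase D (grp D.init g) := fun i => by
    rw [mulLast_mul_mulBase, skewAut_gen, skewDer_gen, hbr, map_smul, smul_mul_assoc]
  refine ⟨base.one, base.mul, fun g i => ?_, fun i j => ?_⟩
  · induction i using Fin.lastCases
    · rw [Fin.lastCases_last, mulLast_mul_mulBase, skewAut_grp, skewDer_grp, map_zero, add_zero,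
        map_smul, smul_mul_assoc, smul_smul, mul_inv_cancel₀ (D.lam_ne _ _), one_smul]
    · simp only [Fin.lastCases_castSucc]
      exact base.comm g _
  · induction i using Fin.lastCases <;> induction j using Fin.lastCases
    · simp [D.q_diag, D.k_diag]
    · simpa only [Fin.lastCases_castSucc, Fin.lastCases_last] using hlast _
    · rw [Fin.lastCases_castSucc, Fin.lastCases_last, hlast, smul_add, smul_smul, D.q_mul,
        one_smul, add_assoc, Finset.smul_sum, ← Finset.sum_add_distrib]
      simp [D.k_swap (Fin.castSucc _) (Fin.last n), smul_smul, ← add_smul]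
    · simp only [Fin.lastCases_castSucc]
      exact base.quad _ _

end QuantumPresentation

/-- The ordered monomial `w_0 ^ m_0 ⋯ w_{n-1} ^ m_{n-1}`. -/
def orderedMonomial {B : Type*} [Monoid B] {n : ℕ} (w : Fin n → B) (m : Fin n → ℕ) : B :=
  (List.ofFn fun i => w i ^ m i).prod

theorem map_orderedMonomial {B C F : Type*} [Monoid B] [Monoid C] [FunLike F B C]
    [MonoidHomClass F B C] (f : F) {n : ℕ} (w : Fin n → B) (m : Fin n → ℕ) :
    f (orderedMonomial w m) = orderedMonomial (fun i => f (w i)) m := by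
  simp [orderedMonomial, map_list_prod, List.map_ofFn, Function.comp_def]

namespace QuantumPresentation

variable {G : Type*} [Group G] {α : NormalizedTwoCocycle G} {n : ℕ} [Fintype G]

theorem mulLast_pow_single_grp (D : Parameters G α (n + 1)) (j : ℕ) (g : G) :
    (mulLast D ^ j) (Finsupp.single 0 (grp D.init g))
      = (D.lam g (Fin.last n))⁻¹ ^ j • Finsupp.single j (grp D.init g) := by
  induction j with
  | zero => simp
  | succ j ih =>
    rw [pow_succ', Module.End.mul_apply, ih, map_smul, mulLast_single, skewAut_grp, skewDer_grp,
      Finsupp.single_zero, add_zero, ← Finsupp.smul_single, smul_smul, pow_succ]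

/-- The group elements are linearly independent in the algebra without variables. -/
theorem linearIndependent_grp (D : Parameters G α 0) : LinearIndependent ℂ (grp D) := by
  have hsat : Satisfies D (fun i => i.elim0) (TwistedGroupAlgebra.t α) :=
    ⟨rfl, fun g h => TwistedSkewGroupAlgebra.term_one_mul_term_one _ _ g h,
      fun _ i => i.elim0, fun i => i.elim0⟩
  refine LinearIndependent.of_comp (lift hsat).toLinearMap ?_
  have : (lift hsat).toLinearMap ∘ grp D = TwistedGroupAlgebra.t α :=
    funext fun g => lift_grp hsat g
  rw [this]
  exact Finsupp.linearIndependent_single_one ℂ G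

/-- The ordered monomials form a linearly independent family, by induction on the number of
variables: acting on the generator of the module given by the Ore extension, a monomial in which the
last variable has exponent `j` yields a monomial in the previous variables, placed in degree `j`. -/
theorem linearIndependent_monomials : ∀ (n : ℕ) (D : Parameters G α n),
    LinearIndependent ℂ
      fun p : (Fin n → ℕ) × G => orderedMonomial (gen D) p.1 * grp D p.2
  | 0, D => by
    have := (linearIndependent_grp D).comp (fun p : (Fin 0 → ℕ) × G => p.2)
      fun p p' h => Prod.ext (Subsingleton.elim _ _) h
    simpa [orderedMonomial, Function.comp_def] using this
  | n + 1, D => by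
    have ih := linearIndependent_monomials n D.init
    let Φ := lift (satisfies_operators D)
    refine LinearIndependent.of_comp
      ((LinearMap.applyₗ (Finsupp.single 0 1)).comp Φ.toLinearMap) ?_
    have hind := (Finsupp.linearIndependent_single (fun _ : ℕ => _) fun _ => ih).comp
      (fun p : (Fin (n + 1) → ℕ) × G => ⟨p.1 (Fin.last n), (fun i => p.1 i.castSucc), p.2⟩)
      (fun p p' h => by
        simp only [Sigma.mk.injEq, heq_eq_eq, Prod.mk.injEq] at h
        refine Prod.ext (funext fun i => ?_) h.2.2
        exact Fin.lastCases h.1 (fun i => congrFun h.2.1 i) i)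
    convert hind.units_smul
      (fun p => (Units.mk0 _ (D.lam_ne p.2 (Fin.last n)))⁻¹ ^ p.1 (Fin.last n)) using 1
    funext p
    have h1 : Φ (orderedMonomial (gen D) p.1 * grp D p.2)
        = mulBase D (orderedMonomial (gen D.init) fun i => p.1 i.castSucc)
          * mulLast D ^ p.1 (Fin.last n) * mulBase D (grp D.init p.2) := by
      rw [map_mul, map_orderedMonomial, map_orderedMonomial, lift_grp]
      simp only [Φ, lift_gen, orderedMonomial]
      rw [List.ofFn_succ']
      simp
    simp only [Function.comp_apply, LinearMap.comp_apply, AlgHom.toLinearMap_apply,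
      LinearMap.applyₗ_apply_apply, h1, Module.End.mul_apply, mulBase_single, mul_one,
      mulLast_pow_single_grp, map_smul, Pi.smul_apply', Units.smul_def, Units.val_pow_eq_pow_val,
      Units.val_inv_eq_inv_val, Units.val_mk0]

end QuantumPresentation

/-! ### Symbols in the associated graded algebra -/

section Symbol

variable {A : Type*} [Ring A] [Algebra ℂ A] (F Flt : ℕ → Submodule ℂ A)

/-- `y` is the symbol of degree `d` of `x`, i.e. the class of `x` in `F d / F_{<d}`, regarded as an
element of the associated graded algebra. (It is zero if `x` has smaller degree.) -/
def IsSymbol (d : ℕ) (x : A) (y : AssociatedGraded F Flt) : Prop :=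
  ∃ h : x ∈ F d, DirectSum.lof ℂ ℕ (GradedPiece F Flt) d (GradedPiece.mk F Flt d ⟨x, h⟩) = y

namespace IsSymbol

variable {F Flt} {d e : ℕ} {x x' : A} {y y' : AssociatedGraded F Flt}

theorem unique (h : IsSymbol F Flt d x y) (h' : IsSymbol F Flt d x y') : y = y' := by
  obtain ⟨_, rfl⟩ := h
  obtain ⟨_, rfl⟩ := h'
  rfl

theorem add (h : IsSymbol F Flt d x y) (h' : IsSymbol F Flt d x' y') :
    IsSymbol F Flt d (x + x') (y + y') := by
  obtain ⟨hx, rfl⟩ := h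
  obtain ⟨hx', rfl⟩ := h'
  exact ⟨add_mem hx hx', by rw [← map_add, ← map_add]; rfl⟩

theorem smul (c : ℂ) (h : IsSymbol F Flt d x y) : IsSymbol F Flt d (c • x) (c • y) := by
  obtain ⟨hx, rfl⟩ := h
  exact ⟨Submodule.smul_mem _ c hx, by rw [← map_smul, ← map_smul]; rfl⟩

theorem zero : IsSymbol F Flt d 0 0 := ⟨zero_mem _, by
  rw [show (⟨0, zero_mem _⟩ : F d) = 0 from rfl, map_zero, map_zero]⟩

theorem sum {ι : Type*} {s : Finset ι} {x : ι → A} {y : ι → AssociatedGraded F Flt}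
    (h : ∀ i ∈ s, IsSymbol F Flt d (x i) (y i)) :
    IsSymbol F Flt d (∑ i ∈ s, x i) (∑ i ∈ s, y i) := by
  classical
  induction s using Finset.induction_on with
  | empty => simpa using zero
  | insert i s hi ih =>
    rw [Finset.sum_insert hi, Finset.sum_insert hi]
    exact (h i (Finset.mem_insert_self i s)).add
      (ih fun j hj => h j (Finset.mem_insert_of_mem hj))

variable [IsRingFiltration F Flt]

theorem one : IsSymbol F Flt 0 1 1 := ⟨SetLike.one_mem_graded F, rfl⟩

theorem mul (h : IsSymbol F Flt d x y) (h' : IsSymbol F Flt e x' y') :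
    IsSymbol F Flt (d + e) (x * x') (y * y') := by
  obtain ⟨hx, rfl⟩ := h
  obtain ⟨hx', rfl⟩ := h'
  refine ⟨SetLike.mul_mem_graded hx hx', ?_⟩
  rw [DirectSum.lof_eq_of, DirectSum.lof_eq_of, DirectSum.lof_eq_of, DirectSum.of_mul_of]
  rfl

theorem mul_of_eq {k : ℕ} (h : IsSymbol F Flt d x y) (h' : IsSymbol F Flt e x' y')
    (hk : d + e = k) : IsSymbol F Flt k (x * x') (y * y') :=
  hk ▸ h.mul h'

theorem pow (h : IsSymbol F Flt d x y) (m : ℕ) : IsSymbol F Flt (m * d) (x ^ m) (y ^ m) := by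
  induction m with
  | zero => simpa using one
  | succ m ih => simpa only [pow_succ, add_mul, one_mul] using ih.mul h

theorem eq_zero_iff (h : IsSymbol F Flt d x y) : y = 0 ↔ x ∈ Flt d := by
  obtain ⟨hx, rfl⟩ := h
  rw [← map_zero (DirectSum.lof ℂ ℕ (GradedPiece F Flt) d),
    DirectSum.lof_eq_of, DirectSum.lof_eq_of, (DirectSum.of_injective d).eq_iff,
    ← map_zero (GradedPiece.mk F Flt d),
    GradedPiece.mk_eq_mk_iff]
  simp

theorem eq_of_sub_mem (h : IsSymbol F Flt d x y) (h' : IsSymbol F Flt d x' y')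
    (hsub : x - x' ∈ Flt d) : y = y' := by
  have := (h.add (h'.smul (-1))).eq_zero_iff.2 (by simpa [sub_eq_add_neg] using hsub)
  simpa [add_neg_eq_zero] using this

end IsSymbol

/-- The elements of degree `d` of the associated graded algebra are the symbols of degree `d`. -/
theorem mem_range_lof_iff {d : ℕ} {y : AssociatedGraded F Flt} :
    y ∈ LinearMap.range (DirectSum.lof ℂ ℕ (GradedPiece F Flt) d) ↔ ∃ x, IsSymbol F Flt d x y := by
  constructor
  · rintro ⟨z, rfl⟩
    obtain ⟨x, rfl⟩ := GradedPiece.mk_surjective F Flt d z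
    exact ⟨x, x.2, rfl⟩
  · rintro ⟨x, hx, rfl⟩
    exact ⟨_, rfl⟩

theorem iSup_range_lof {M : ℕ → Type*} [∀ i, AddCommGroup (M i)] [∀ i, Module ℂ (M i)] :
    ⨆ i, LinearMap.range (DirectSum.lof ℂ ℕ M i) = ⊤ :=
  DFinsupp.iSup_range_lsingle

theorem linearIndependent_lof {M : ℕ → Type*} [∀ i, AddCommGroup (M i)] [∀ i, Module ℂ (M i)]
    {I : ℕ → Type*} (f : ∀ i, I i → M i) (hf : ∀ i, LinearIndependent ℂ (f i)) :
    LinearIndependent ℂ fun p : Σ i, I i => DirectSum.lof ℂ ℕ M p.1 (f p.1 p.2) :=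
  DFinsupp.linearIndependent_single f hf

theorem IsSymbol.orderedMonomial {F Flt : ℕ → Submodule ℂ A} [IsRingFiltration F Flt] :
    ∀ {n : ℕ} {w : Fin n → A} {u : Fin n → AssociatedGraded F Flt}
      (_ : ∀ i, IsSymbol F Flt 1 (w i) (u i)) (m : Fin n → ℕ),
      IsSymbol F Flt (∑ i, m i) (orderedMonomial w m) (orderedMonomial u m)
  | 0, _, _, _, _ => by simpa [_root_.orderedMonomial] using IsSymbol.one
  | n + 1, w, u, h, m => by
    have := ((h 0).pow (m 0)).mul (IsSymbol.orderedMonomial (fun i => h i.succ) fun i => m i.succ)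
    simpa [_root_.orderedMonomial, Fin.sum_univ_succ] using this

end Symbol

/-! ### Quantum symmetric algebras -/

section QuantumSymmetric

variable {G V : Type*} [Group G] [AddCommGroup V] [Module ℂ V] {n : ℕ}

theorem tensorAction_ι (ρ : Representation ℂ G V) (g : G) (x : V) :
    tensorAction ρ g (TensorAlgebra.ι ℂ x) = TensorAlgebra.ι ℂ (ρ g x) :=
  tensorMap_ι _ x

/-- An identity `t f(a) = f(ᵍa) t` may be checked for `a ∈ V`. -/
theorem commute_tensorAction {B : Type*} [Semiring B] [Algebra ℂ B] (ρ : Representation ℂ G V)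
    (f : TensorAlgebra ℂ V →ₐ[ℂ] B) (g : G) (t : B)
    (h : ∀ x, t * f (TensorAlgebra.ι ℂ x) = f (TensorAlgebra.ι ℂ (ρ g x)) * t)
    (a : TensorAlgebra ℂ V) : t * f a = f (tensorAction ρ g a) * t := by
  induction a using TensorAlgebra.induction with
  | algebraMap r => rw [AlgEquiv.commutes, AlgHom.commutes, Algebra.commutes]
  | ι x => rw [tensorAction_ι, h]
  | mul a b ha hb => rw [map_mul, map_mul, map_mul, ← mul_assoc, ha, mul_assoc, hb, mul_assoc]
  | add a b ha hb => rw [map_add, map_add, map_add, mul_add, add_mul, ha, hb]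

namespace QuantumSymmetricAlgebra

variable (v : Module.Basis (Fin n) ℂ V) (q : Fin n → Fin n → ℂ)

/-- The quotient map from the tensor algebra. -/
def mk : TensorAlgebra ℂ V →ₐ[ℂ] QuantumSymmetricAlgebra v q :=
  RingQuot.mkAlgHom ℂ (QuantumSymmetricRel v q)

theorem mk_ι (x : V) : mk v q (TensorAlgebra.ι ℂ x) = ι v q x := rfl

theorem mk_surjective : Function.Surjective (mk v q) := RingQuot.mkAlgHom_surjective ℂ _

theorem ι_mul_ι (i j : Fin n) :
    ι v q (v i) * ι v q (v j) = q i j • (ι v q (v j) * ι v q (v i)) := by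
  simpa [← mk_ι, mk] using RingQuot.mkAlgHom_rel ℂ (QuantumSymmetricRel.mk (v := v) (q := q) i j)

theorem map_tensorComponent (d : ℕ) :
    (tensorComponent V d).map (mk v q).toLinearMap = component v q d := by
  rw [tensorComponent, component, Submodule.map_pow, ← LinearMap.range_comp]
  rfl

/-- The universal property of `S_q(V)`. -/
def lift {B : Type*} [Semiring B] [Algebra ℂ B] (f : V →ₗ[ℂ] B)
    (hf : ∀ i j, f (v i) * f (v j) = q i j • (f (v j) * f (v i))) :
    QuantumSymmetricAlgebra v q →ₐ[ℂ] B :=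
  RingQuot.liftAlgHom ℂ ⟨TensorAlgebra.lift ℂ f, by rintro _ _ ⟨i, j⟩; simpa using hf i j⟩

theorem lift_mk {B : Type*} [Semiring B] [Algebra ℂ B] (f : V →ₗ[ℂ] B)
    (hf : ∀ i j, f (v i) * f (v j) = q i j • (f (v j) * f (v i))) (a : TensorAlgebra ℂ V) :
    lift v q f hf (mk v q a) = TensorAlgebra.lift ℂ f a := by
  simp [lift, mk]

theorem lift_ι {B : Type*} [Semiring B] [Algebra ℂ B] (f : V →ₗ[ℂ] B)
    (hf : ∀ i j, f (v i) * f (v j) = q i j • (f (v j) * f (v i))) (x : V) :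
    lift v q f hf (ι v q x) = f x := by
  rw [← mk_ι, lift_mk, TensorAlgebra.lift_ι_apply]

variable {v q} in
theorem algHom_ext {B : Type*} [Semiring B] [Algebra ℂ B]
    {f f' : QuantumSymmetricAlgebra v q →ₐ[ℂ] B}
    (h : ∀ x, f (ι v q x) = f' (ι v q x)) : f = f' :=
  RingQuot.ringQuot_ext' ℂ _ _ (TensorAlgebra.hom_ext (LinearMap.ext h))

/-- Elements of degree one are detected by homomorphisms to the dual numbers sending `V` to
multiples of `ε`, since all products of two elements of `V` vanish there. -/
theorem ι_injective : Function.Injective (ι v q) := by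
  refine (injective_iff_map_eq_zero (ι v q)).2 fun x hx => v.ext_elem fun i => ?_
  have hf : ∀ a b, (TrivSqZeroExt.inrHom ℂ ℂ ∘ₗ v.coord i) (v a)
        * (TrivSqZeroExt.inrHom ℂ ℂ ∘ₗ v.coord i) (v b)
      = q a b • ((TrivSqZeroExt.inrHom ℂ ℂ ∘ₗ v.coord i) (v b)
        * (TrivSqZeroExt.inrHom ℂ ℂ ∘ₗ v.coord i) (v a)) := fun a b => by
    simp
  have h := lift_ι v q _ hf x
  rw [hx, map_zero] at h
  simpa using (TrivSqZeroExt.inr_injective (R := ℂ) (by simpa using h.symm) : v.coord i x = 0)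

theorem one_ne_zero' : (1 : QuantumSymmetricAlgebra v q) ≠ 0 := by
  intro h
  have := congrArg (lift v q (0 : V →ₗ[ℂ] ℂ) (fun i j => by simp)) h
  simp at this

/-- A diagonal group action on `V` extends to `S_q(V)`. -/
theorem exists_action (ρ : Representation ℂ G V) (lam : G → Fin n → ℂ)
    (hlam : ∀ g i, ρ g (v i) = lam g i • v i) :
    ∃ φ : G →* (QuantumSymmetricAlgebra v q ≃ₐ[ℂ] QuantumSymmetricAlgebra v q),
      ∀ g x, φ g (ι v q x) = ι v q (ρ g x) := by
  let f (g : G) : QuantumSymmetricAlgebra v q →ₐ[ℂ] QuantumSymmetricAlgebra v q :=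
    lift v q ((ι v q).comp (ρ g)) fun i j => by
      simp only [LinearMap.comp_apply, hlam, map_smul, smul_mul_assoc, mul_smul_comm,
        ι_mul_ι v q i j]
      rw [smul_comm (lam g i) (q i j), smul_comm (lam g j) (q i j), smul_comm (lam g i) (lam g j)]
  have hf : ∀ g x, f g (ι v q x) = ι v q (ρ g x) := fun g x => lift_ι _ _ _ _ x
  have hmul : ∀ g h, (f g).comp (f h) = f (g * h) := fun g h => algHom_ext fun x => by
    simp [hf, map_mul]
  have hone : f 1 = AlgHom.id ℂ _ := algHom_ext fun x => by simp [hf]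
  refine ⟨⟨⟨fun g => AlgEquiv.ofAlgHom (f g) (f g⁻¹) ?_ ?_, ?_⟩, ?_⟩, hf⟩
  · rw [hmul, mul_inv_cancel, hone]
  · rw [hmul, inv_mul_cancel, hone]
  · ext x
    simp [hone]
  · intro g h
    ext x
    simp [← hmul]

variable {v q} in
theorem action_mk {ρ : Representation ℂ G V}
    {φ : G →* (QuantumSymmetricAlgebra v q ≃ₐ[ℂ] QuantumSymmetricAlgebra v q)}
    (hφ : ∀ g x, φ g (ι v q x) = ι v q (ρ g x)) (g : G) (a : TensorAlgebra ℂ V) :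
    φ g (mk v q a) = mk v q (tensorAction ρ g a) := by
  have : (φ g : QuantumSymmetricAlgebra v q →ₐ[ℂ] QuantumSymmetricAlgebra v q).comp (mk v q)
      = (mk v q).comp (tensorAction ρ g : TensorAlgebra ℂ V →ₐ[ℂ] TensorAlgebra ℂ V) := by
    refine TensorAlgebra.hom_ext (LinearMap.ext fun x => ?_)
    simp [mk_ι, hφ, tensorAction_ι]
  exact congrArg (fun f => f a) this

/-- Left multiplication by a generator permutes the ordered monomials up to scalars. -/
theorem mul_orderedMonomial {B : Type*} [Semiring B] [Algebra ℂ B] :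
    ∀ {n : ℕ} {q : Fin n → Fin n → ℂ} {w : Fin n → B}
      (_ : ∀ i j, w i * w j = q i j • (w j * w i)) (i : Fin n) (m : Fin n → ℕ),
      ∃ (c : ℂ) (m' : Fin n → ℕ), ∑ i, m' i = ∑ i, m i + 1 ∧
        w i * orderedMonomial w m = c • orderedMonomial w m'
  | n + 1, q, w, hw, i, m => by
    induction i using Fin.cases with
    | zero =>
      refine ⟨1, Fin.cons (m 0 + 1) fun i => m i.succ, ?_, ?_⟩
      · simp only [Fin.sum_univ_succ, Fin.cons_zero, Fin.cons_succ]
        ring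
      · simp [orderedMonomial, pow_succ', mul_assoc]
    | succ i =>
      obtain ⟨c, m', hdeg, h⟩ :=
        mul_orderedMonomial (fun i j => hw i.succ j.succ) i fun i => m i.succ
      have hpow : ∀ k : ℕ, w i.succ * w 0 ^ k = q i.succ 0 ^ k • (w 0 ^ k * w i.succ) := fun k => by
        induction k with
        | zero => simp
        | succ k ih =>
          rw [pow_succ, ← mul_assoc, ih, smul_mul_assoc, mul_assoc, hw, mul_smul_comm, smul_smul,
            mul_assoc, pow_succ]
      refine ⟨q i.succ 0 ^ m 0 * c, Fin.cons (m 0) m', ?_, ?_⟩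
      · simp only [Fin.sum_univ_succ, Fin.cons_zero, Fin.cons_succ, hdeg, add_assoc]
      · simp only [orderedMonomial, List.ofFn_succ, List.prod_cons, Fin.cons_zero,
          Fin.cons_succ] at h ⊢
        rw [← mul_assoc, hpow, smul_mul_assoc, mul_assoc, h, mul_smul_comm, smul_smul]

/-- The ordered monomials of degree `d` span the component of degree `d` of `S_q(V)`. -/
theorem component_le_span (d : ℕ) :
    component v q d ≤ Submodule.span ℂ
      ((fun m : Fin n → ℕ => orderedMonomial (fun i => ι v q (v i)) m) '' {m | ∑ i, m i = d}) := by
  intro x hx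
  refine Submodule.pow_induction_on_left' _ (C := fun d x _ => x ∈ Submodule.span ℂ
    ((fun m : Fin n → ℕ => orderedMonomial (fun i => ι v q (v i)) m) '' {m | ∑ i, m i = d}))
    (fun r => ?_) (fun x y i _ _ hx hy => add_mem hx hy) (fun y hy d x _ hx => ?_) hx
  · rw [Algebra.algebraMap_eq_smul_one]
    exact Submodule.smul_mem _ _ (Submodule.subset_span ⟨0, by simp, by simp [orderedMonomial]⟩)
  · obtain ⟨y, rfl⟩ := hy
    refine Submodule.span_induction ?_ (by simp) (fun x x' _ _ hx hx' => ?_) (fun c x _ hx => ?_) hx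
    · rintro _ ⟨m, hm, rfl⟩
      rw [← v.sum_repr y, map_sum, Finset.sum_mul]
      refine Submodule.sum_mem _ fun i _ => ?_
      rw [map_smul, smul_mul_assoc]
      obtain ⟨c, m', hdeg, h⟩ := mul_orderedMonomial (fun i j => ι_mul_ι v q i j) i m
      simp only [h]
      refine Submodule.smul_mem _ _ (Submodule.smul_mem _ _ (Submodule.subset_span
        ⟨m', hdeg.trans (congrArg (· + 1) hm), rfl⟩))
    · rw [mul_add]
      exact add_mem hx hx'
    · rw [mul_smul_comm]
      exact Submodule.smul_mem _ _ hx

theorem iSup_component : ⨆ d, component v q d = ⊤ := by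
  have h : ⨆ d, tensorComponent V d = ⊤ :=
    (DirectSum.Decomposition.isInternal fun d : ℕ =>
      LinearMap.range (TensorAlgebra.ι ℂ : V →ₗ[ℂ] TensorAlgebra ℂ V) ^ d).submodule_iSup_eq_top
  simp_rw [← map_tensorComponent, ← Submodule.map_iSup, h, Submodule.map_top]
  exact LinearMap.range_eq_top.2 (mk_surjective v q)

end QuantumSymmetricAlgebra

end QuantumSymmetric

/-! ### The conditions on `κ` -/

section Hecke

variable {G V : Type*} [Group G] [AddCommGroup V] [Module ℂ V] {n : ℕ}

/-- The conditions on the coefficients `k i j g` of `t_g` in `κ(v_i, v_j)` that characterise the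
twisted quantum Drinfeld Hecke algebras: quantum antisymmetry, the quantum Jacobi identity,
and invariance under `G`. -/
structure HeckeConditions (q : Fin n → Fin n → ℂ) (α : NormalizedTwoCocycle G)
    (lam : G → Fin n → ℂ) (k : Fin n → Fin n → G → ℂ) : Prop where
  swap : ∀ i j g, k i j g = -(q i j * k j i g)
  lam_eq : ∀ i j l g, i ≠ j → l ≠ i → l ≠ j → k i j g ≠ 0 → lam g l = q i l * q j l
  conj : ∀ i j h a, lam h i * lam h j * k i j (h * a * h⁻¹) * α (h * a * h⁻¹) h = α h a * k i j a

section Eigenvalues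

variable {v : Module.Basis (Fin n) ℂ V} {ρ : Representation ℂ G V} {lam : G → Fin n → ℂ}

theorem eigenvalue_one (hlam : ∀ g i, ρ g (v i) = lam g i • v i) (i : Fin n) : lam 1 i = 1 := by
  have h := hlam 1 i
  rw [map_one, Module.End.one_apply] at h
  have := congrArg (fun x => v.repr x i) h
  simpa using this.symm

theorem eigenvalue_mul (hlam : ∀ g i, ρ g (v i) = lam g i • v i) (g h : G) (i : Fin n) :
    lam (g * h) i = lam g i * lam h i := by
  have h := hlam (g * h) i
  rw [map_mul, Module.End.mul_apply, hlam, map_smul, hlam] at h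
  have := congrArg (fun x => v.repr x i) h
  simpa [mul_comm] using this.symm

theorem eigenvalue_ne_zero (hlam : ∀ g i, ρ g (v i) = lam g i • v i) (g : G) (i : Fin n) :
    lam g i ≠ 0 := by
  have h := eigenvalue_mul hlam g g⁻¹ i
  rw [mul_inv_cancel, eigenvalue_one hlam] at h
  exact left_ne_zero_of_mul (h ▸ one_ne_zero)

end Eigenvalues

/-- The coefficient of `t_g` in `κ(v_i, v_j)`. -/
def bracketCoeff (v : Module.Basis (Fin n) ℂ V) (α : NormalizedTwoCocycle G)
    (κ : V →ₗ[ℂ] V →ₗ[ℂ] TwistedGroupAlgebra α) (i j : Fin n) (g : G) : ℂ :=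
  TwistedSkewGroupAlgebra.coeff 1 α g (κ (v i) (v j))

theorem TwistedGroupAlgebra.incl_eq_sum [Fintype G] {A : Type*} [Ring A] [Algebra ℂ A]
    (φ : G →* (A ≃ₐ[ℂ] A)) (α : NormalizedTwoCocycle G) (y : TwistedGroupAlgebra α) :
    TwistedGroupAlgebra.incl φ α y
      = ∑ g, TwistedSkewGroupAlgebra.coeff 1 α g y • TwistedSkewGroupAlgebra.term φ α g 1 := by
  classical
  induction y using TwistedSkewGroupAlgebra.induction with
  | h0 => simp
  | hadd x y hx hy => simp only [map_add, hx, hy, add_smul, Finset.sum_add_distrib]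
  | hterm g c =>
    simp only [incl, TwistedSkewGroupAlgebra.liftLin_term, TwistedSkewGroupAlgebra.coeff_term,
      ite_smul, zero_smul, Finset.sum_ite_eq, Finset.mem_univ, if_true, LinearMap.comp_apply,
      Algebra.linearMap_apply]
    rw [← map_smul, Algebra.algebraMap_eq_smul_one]

/-! ### Generators of `H_{q,κ,α}` and linear independence of ordered monomials -/

namespace QuantumHecke

variable (v : Module.Basis (Fin n) ℂ V) (ρ : Representation ℂ G V) (q : Fin n → Fin n → ℂ)
  (α : NormalizedTwoCocycle G) (κ : V →ₗ[ℂ] V →ₗ[ℂ] TwistedGroupAlgebra α)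

/-- The quotient map `T(V) #_α G → H_{q,κ,α}`. -/
def proj : TwistedTensor ρ α →ₐ[ℂ] QuantumHecke v ρ q α κ :=
  RingQuot.mkAlgHom ℂ (QuantumHeckeRel v ρ q α κ)

/-- The image of `t_g` in `H_{q,κ,α}`. -/
def grp (g : G) : QuantumHecke v ρ q α κ :=
  proj v ρ q α κ (TwistedSkewGroupAlgebra.term (tensorAction ρ) α g 1)

/-- The image of `T(V)` in `H_{q,κ,α}`. -/
def ofTensor : TensorAlgebra ℂ V →ₐ[ℂ] QuantumHecke v ρ q α κ :=
  (proj v ρ q α κ).comp (TwistedSkewGroupAlgebra.inclusion (tensorAction ρ) α)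

/-- The canonical map `V → H_{q,κ,α}`. -/
def vec : V →ₗ[ℂ] QuantumHecke v ρ q α κ :=
  (ofTensor v ρ q α κ).toLinearMap.comp (TensorAlgebra.ι ℂ)

theorem proj_term (g : G) (a : TensorAlgebra ℂ V) :
    proj v ρ q α κ (TwistedSkewGroupAlgebra.term (tensorAction ρ) α g a)
      = ofTensor v ρ q α κ a * grp v ρ q α κ g := by
  rw [grp, ofTensor, AlgHom.comp_apply, ← map_mul, TwistedSkewGroupAlgebra.inclusion_mul_term]

theorem ofTensor_ι (x : V) : ofTensor v ρ q α κ (TensorAlgebra.ι ℂ x) = vec v ρ q α κ x := rfl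

theorem grp_one : grp v ρ q α κ 1 = 1 := map_one (proj v ρ q α κ)

theorem grp_mul (g h : G) :
    grp v ρ q α κ g * grp v ρ q α κ h = (α g h : ℂ) • grp v ρ q α κ (g * h) := by
  rw [grp, grp, ← map_mul, TwistedSkewGroupAlgebra.term_one_mul_term_one, map_smul]
  rfl

theorem grp_mul_vec (g : G) (x : V) :
    grp v ρ q α κ g * vec v ρ q α κ x = vec v ρ q α κ (ρ g x) * grp v ρ q α κ g := by
  rw [← ofTensor_ι, ← ofTensor_ι, ← proj_term, ← tensorAction_ι,
    ← TwistedSkewGroupAlgebra.term_mul_inclusion, map_mul]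
  rfl

theorem vec_mul_vec [Fintype G] (i j : Fin n) :
    vec v ρ q α κ (v i) * vec v ρ q α κ (v j)
      = q i j • (vec v ρ q α κ (v j) * vec v ρ q α κ (v i))
        + ∑ g, bracketCoeff v α κ i j g • grp v ρ q α κ g := by
  have h := RingQuot.mkAlgHom_rel ℂ (QuantumHeckeRel.mk (v := v) (ρ := ρ) (q := q) (κ := κ) i j)
  rw [TwistedGroupAlgebra.incl_eq_sum, map_add, map_smul, map_sum] at h
  simp only [map_smul] at h
  rw [← ofTensor_ι, ← ofTensor_ι, ← map_mul (ofTensor v ρ q α κ),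
    ← map_mul (ofTensor v ρ q α κ)]
  exact h

/-- The product `v_0 ^ m_0 ⋯ v_{n-1} ^ m_{n-1} t_g` in `H_{q,κ,α}`. -/
def monomial (p : (Fin n → ℕ) × G) : QuantumHecke v ρ q α κ :=
  orderedMonomial (fun i => vec v ρ q α κ (v i)) p.1 * grp v ρ q α κ p.2

variable {v ρ q α κ} {lam : G → Fin n → ℂ}

/-- The Poincaré–Birkhoff–Witt theorem for `H_{q,κ,α}`. -/
theorem linearIndependent_monomial [Fintype G] (hq_ne : ∀ i j, q i j ≠ 0)
    (hq_diag : ∀ i, q i i = 1) (hq_inv : ∀ i j, q j i = (q i j)⁻¹)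
    (hlam : ∀ g i, ρ g (v i) = lam g i • v i)
    (hk : HeckeConditions q α lam (bracketCoeff v α κ)) :
    LinearIndependent ℂ (monomial v ρ q α κ) := by
  let D : QuantumPresentation.Parameters G α n :=
    { q := q, lam := lam, k := bracketCoeff v α κ
      q_diag := hq_diag
      q_mul := fun i j => by rw [hq_inv i j, mul_inv_cancel₀ (hq_ne i j)]
      lam_ne := eigenvalue_ne_zero hlam
      lam_one := eigenvalue_one hlam
      lam_mul := eigenvalue_mul hlam
      k_diag := fun i g => by
        have := hk.swap i i g
        rwa [hq_diag, one_mul, self_eq_neg] at this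
      k_swap := hk.swap
      lam_eq := hk.lam_eq
      k_conj := hk.conj }
  have hD := QuantumPresentation.satisfies_pres D
  let f : TensorAlgebra ℂ V →ₐ[ℂ] QuantumPresentation.Pres D :=
    TensorAlgebra.lift ℂ (v.constr ℂ (QuantumPresentation.gen D))
  have hf : ∀ i, f (TensorAlgebra.ι ℂ (v i)) = QuantumPresentation.gen D i := fun i => by
    simp [f]
  have hcomm : ∀ g a, QuantumPresentation.grp D g * f a
      = f (tensorAction ρ g a) * QuantumPresentation.grp D g := fun g a => by
    refine commute_tensorAction ρ f g _ (fun x => ?_) a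
    have : (LinearMap.mulLeft ℂ (QuantumPresentation.grp D g)).comp
          (f.toLinearMap.comp (TensorAlgebra.ι ℂ))
        = (LinearMap.mulRight ℂ (QuantumPresentation.grp D g)).comp
          ((f.toLinearMap.comp (TensorAlgebra.ι ℂ)).comp (ρ g)) := by
      refine v.ext fun i => ?_
      simp only [LinearMap.comp_apply, LinearMap.mulLeft_apply, LinearMap.mulRight_apply,
        AlgHom.toLinearMap_apply, hlam, map_smul, hf]
      exact hD.comm g i
    exact LinearMap.congr_fun this x
  let Ψ₀ := TwistedSkewGroupAlgebra.liftHom (tensorAction ρ) α f (QuantumPresentation.grp D)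
    hD.one hD.mul hcomm
  have hΨ₀ : ∀ g a, Ψ₀ (TwistedSkewGroupAlgebra.term _ _ g a) = f a * QuantumPresentation.grp D g :=
    TwistedSkewGroupAlgebra.liftHom_term _ _ _ _ _ _ _
  let Ψ : QuantumHecke v ρ q α κ →ₐ[ℂ] QuantumPresentation.Pres D :=
    RingQuot.liftAlgHom ℂ ⟨Ψ₀, by
      rintro _ _ ⟨i, j⟩
      rw [TwistedGroupAlgebra.incl_eq_sum, map_add, map_smul, map_sum]
      simp only [map_smul, hΨ₀, map_mul, map_one, one_mul, hf, hD.one, mul_one]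
      exact hD.quad i j⟩
  have hΨ : ∀ x, Ψ (proj v ρ q α κ x) = Ψ₀ x := fun x => by simp [Ψ, proj]
  have hgrp : ∀ g, Ψ (grp v ρ q α κ g) = QuantumPresentation.grp D g := fun g => by
    rw [grp, hΨ, hΨ₀, map_one, one_mul]
  have hvec : ∀ i, Ψ (vec v ρ q α κ (v i)) = QuantumPresentation.gen D i := fun i => by
    change Ψ (proj v ρ q α κ (TwistedSkewGroupAlgebra.term _ _ 1 _)) = _
    rw [hΨ, hΨ₀, hf, hD.one, mul_one]
  refine LinearIndependent.of_comp Ψ.toLinearMap ?_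
  have hcomp : Ψ.toLinearMap ∘ monomial v ρ q α κ = fun p =>
      orderedMonomial (QuantumPresentation.gen D) p.1 * QuantumPresentation.grp D p.2 := by
    funext p
    simp [monomial, map_orderedMonomial, hgrp, hvec]
  rw [hcomp]
  exact QuantumPresentation.linearIndependent_monomials n D

/-! ### The filtration and symbols of `H_{q,κ,α}` -/

variable (v ρ q α κ)

/-- `y` is the symbol of degree `d` of `x` with respect to the filtration of `H_{q,κ,α}`. -/
abbrev Symb (d : ℕ) (x : QuantumHecke v ρ q α κ)
    (y : AssociatedGraded (filtration v ρ q α κ) (filtrationLT v ρ q α κ)) : Prop :=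
  IsSymbol (filtration v ρ q α κ) (filtrationLT v ρ q α κ) d x y

variable {v ρ q α κ}

theorem proj_mem_filtration {d : ℕ} {x : TwistedTensor ρ α}
    (hx : x ∈ TwistedSkewGroupAlgebra.homogeneous (tensorAction ρ) α (tensorComponent V) d) :
    proj v ρ q α κ x ∈ filtration v ρ q α κ d :=
  Submodule.mem_map_of_mem (Submodule.mem_iSup_of_mem d (Submodule.mem_iSup_of_mem le_rfl hx))

theorem grp_mem_filtration (g : G) : grp v ρ q α κ g ∈ filtration v ρ q α κ 0 :=
  proj_mem_filtration (TwistedSkewGroupAlgebra.term_mem_homogeneous _ _ g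
    (SetLike.one_mem_graded (tensorComponent V)))

theorem vec_mem_filtration (x : V) : vec v ρ q α κ x ∈ filtration v ρ q α κ 1 :=
  proj_mem_filtration (TwistedSkewGroupAlgebra.term_mem_homogeneous _ _ 1 (by
    rw [tensorComponent, pow_one]
    exact ⟨x, rfl⟩))

theorem filtration_le_filtrationLT {d e : ℕ} (h : d < e) :
    filtration v ρ q α κ d ≤ filtrationLT v ρ q α κ e :=
  IsFiltration.is_le (F := filtration v ρ q α κ) h

/-- Every element of `F d` is the sum of the image of a homogeneous element of degree `d` and of an
element of `F_{<d}`. -/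
theorem filtration_le_sup (d : ℕ) : filtration v ρ q α κ d ≤
    (TwistedSkewGroupAlgebra.homogeneous (tensorAction ρ) α (tensorComponent V) d).map
      (proj v ρ q α κ).toLinearMap ⊔ filtrationLT v ρ q α κ d := by
  rw [filtration, Submodule.map_iSup]
  refine iSup_le fun k => ?_
  rw [Submodule.map_iSup]
  refine iSup_le fun hk => ?_
  rcases hk.eq_or_lt with rfl | hk
  · exact le_sup_left
  · refine le_sup_of_le_right (le_trans ?_ (filtration_le_filtrationLT hk))
    rintro _ ⟨x, hx, rfl⟩
    exact proj_mem_filtration hx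

/-- A homomorphism from `S_q(V) #_α G` to the associated graded algebra is the symbol map if it
takes the generators `t_g` and `x ∈ V` to the symbols, of degrees zero and one, of the corresponding
generators of `H_{q,κ,α}`. -/
structure IsSymbolMap
    {φ : G →* (QuantumSymmetricAlgebra v q ≃ₐ[ℂ] QuantumSymmetricAlgebra v q)}
    (Φ : TwistedSkewGroupAlgebra φ α →ₐ[ℂ]
      AssociatedGraded (filtration v ρ q α κ) (filtrationLT v ρ q α κ)) : Prop where
  grp : ∀ g, Symb v ρ q α κ 0 (grp v ρ q α κ g) (Φ (TwistedSkewGroupAlgebra.term φ α g 1))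
  vec : ∀ x, Symb v ρ q α κ 1 (vec v ρ q α κ x)
    (Φ (TwistedSkewGroupAlgebra.inclusion φ α (QuantumSymmetricAlgebra.ι v q x)))

/-- The symbol map exists because the bracket `κ`, of filtration degree zero, does not contribute to
the relations in degree two of the associated graded algebra. -/
theorem exists_symbolMap [Fintype G]
    {φ : G →* (QuantumSymmetricAlgebra v q ≃ₐ[ℂ] QuantumSymmetricAlgebra v q)}
    (hφ : ∀ g x, φ g (QuantumSymmetricAlgebra.ι v q x) = QuantumSymmetricAlgebra.ι v q (ρ g x)) :
    ∃ Φ : TwistedSkewGroupAlgebra φ α →ₐ[ℂ]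
        AssociatedGraded (filtration v ρ q α κ) (filtrationLT v ρ q α κ), IsSymbolMap Φ := by
  let u : V →ₗ[ℂ] AssociatedGraded (filtration v ρ q α κ) (filtrationLT v ρ q α κ) :=
    (DirectSum.lof ℂ ℕ (GradedPiece (filtration v ρ q α κ) (filtrationLT v ρ q α κ)) 1) ∘ₗ
      GradedPiece.mk (filtration v ρ q α κ) (filtrationLT v ρ q α κ) 1 ∘ₗ
      (vec v ρ q α κ).codRestrict (filtration v ρ q α κ 1) vec_mem_filtration
  have hu : ∀ x, Symb v ρ q α κ 1 (vec v ρ q α κ x) (u x) := fun x => ⟨vec_mem_filtration x, rfl⟩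
  let τ (g : G) : AssociatedGraded (filtration v ρ q α κ) (filtrationLT v ρ q α κ) :=
    DirectSum.lof ℂ ℕ (GradedPiece (filtration v ρ q α κ) (filtrationLT v ρ q α κ)) 0
      (GradedPiece.mk _ _ 0 ⟨grp v ρ q α κ g, grp_mem_filtration g⟩)
  have hτ : ∀ g, Symb v ρ q α κ 0 (grp v ρ q α κ g) (τ g) := fun g => ⟨grp_mem_filtration g, rfl⟩
  have hτ1 : τ 1 = 1 := by
    have := hτ 1
    rw [grp_one] at this
    exact this.unique IsSymbol.one
  have hτmul : ∀ g h, τ g * τ h = (α g h : ℂ) • τ (g * h) := fun g h => by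
    have := (hτ g).mul_of_eq (hτ h) (add_zero 0)
    rw [grp_mul] at this
    exact this.unique ((hτ (g * h)).smul _)
  have hτu : ∀ g x, τ g * u x = u (ρ g x) * τ g := fun g x => by
    have h1 := (hτ g).mul_of_eq (hu x) (zero_add 1)
    have h2 := (hu (ρ g x)).mul_of_eq (hτ g) (add_zero 1)
    rw [grp_mul_vec] at h1
    exact h1.unique h2
  -- in degree two the bracket, of filtration degree zero, disappears
  have huu : ∀ i j, u (v i) * u (v j) = q i j • (u (v j) * u (v i)) := fun i j => by
    refine ((hu (v i)).mul (hu (v j))).eq_of_sub_mem (((hu (v j)).mul (hu (v i))).smul (q i j)) ?_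
    rw [vec_mul_vec, add_sub_cancel_left]
    exact filtration_le_filtrationLT (by norm_num) (Submodule.sum_mem _ fun g _ =>
      Submodule.smul_mem _ _ (grp_mem_filtration g))
  let f := QuantumSymmetricAlgebra.lift v q u huu
  have hcomm : ∀ g a, τ g * f a = f (φ g a) * τ g := fun g a => by
    obtain ⟨a, rfl⟩ := QuantumSymmetricAlgebra.mk_surjective v q a
    rw [QuantumSymmetricAlgebra.action_mk hφ]
    refine commute_tensorAction ρ (f.comp (QuantumSymmetricAlgebra.mk v q)) g (τ g) (fun x => ?_) a
    simp only [AlgHom.comp_apply, QuantumSymmetricAlgebra.mk_ι, f, QuantumSymmetricAlgebra.lift_ι]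
    exact hτu g x
  refine ⟨TwistedSkewGroupAlgebra.liftHom φ α f τ hτ1 hτmul hcomm, fun g => ?_, fun x => ?_⟩
  · rw [TwistedSkewGroupAlgebra.liftHom_term, map_one, one_mul]
    exact hτ g
  · rw [TwistedSkewGroupAlgebra.inclusion_apply, TwistedSkewGroupAlgebra.liftHom_term, hτ1, mul_one]
    simp only [f, QuantumSymmetricAlgebra.lift_ι]
    exact hu x

end QuantumHecke

end Hecke

section Hecke

variable {G V : Type*} [Group G] [AddCommGroup V] [Module ℂ V] {n : ℕ}

namespace QuantumHecke

variable {v : Module.Basis (Fin n) ℂ V} {ρ : Representation ℂ G V} {q : Fin n → Fin n → ℂ}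
  {α : NormalizedTwoCocycle G} {κ : V →ₗ[ℂ] V →ₗ[ℂ] TwistedGroupAlgebra α} {lam : G → Fin n → ℂ}

/-! ### The associated graded algebra under the conditions on `κ` -/

section SymbolMap

variable {φ : G →* (QuantumSymmetricAlgebra v q ≃ₐ[ℂ] QuantumSymmetricAlgebra v q)}
  {Φ : TwistedSkewGroupAlgebra φ α →ₐ[ℂ]
    AssociatedGraded (filtration v ρ q α κ) (filtrationLT v ρ q α κ)}

theorem symb_term (hΦ : IsSymbolMap Φ) (g : G) {d : ℕ} {a : TensorAlgebra ℂ V}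
    (ha : a ∈ tensorComponent V d) :
    Symb v ρ q α κ d (proj v ρ q α κ (TwistedSkewGroupAlgebra.term (tensorAction ρ) α g a))
      (Φ (TwistedSkewGroupAlgebra.term φ α g (QuantumSymmetricAlgebra.mk v q a))) := by
  have h : Symb v ρ q α κ d (ofTensor v ρ q α κ a)
      (Φ (TwistedSkewGroupAlgebra.inclusion φ α (QuantumSymmetricAlgebra.mk v q a))) := by
    refine Submodule.pow_induction_on_left' _ (C := fun d a _ =>
      Symb v ρ q α κ d (ofTensor v ρ q α κ a)
        (Φ (TwistedSkewGroupAlgebra.inclusion φ α (QuantumSymmetricAlgebra.mk v q a))))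
      (fun r => ?_) (fun x y i _ _ hx hy => ?_) (fun x hx d a _ ha => ?_) ha
    · simp only [Algebra.algebraMap_eq_smul_one, map_smul, map_one]
      exact IsSymbol.one.smul r
    · simpa only [map_add] using hx.add hy
    · obtain ⟨x, rfl⟩ := hx
      rw [map_mul, map_mul, map_mul, map_mul]
      exact (hΦ.vec x).mul_of_eq ha (add_comm 1 d)
  rw [proj_term, ← TwistedSkewGroupAlgebra.inclusion_mul_term, map_mul]
  exact h.mul_of_eq (hΦ.grp g) (add_zero d)

/-- The symbol map takes the grading of `S_q(V) #_α G` onto the grading of the associated graded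
algebra. -/
theorem map_homogeneous (hΦ : IsSymbolMap Φ) (d : ℕ) :
    (TwistedSkewGroupAlgebra.homogeneous φ α (QuantumSymmetricAlgebra.component v q) d).map
        Φ.toLinearMap
      = LinearMap.range (DirectSum.lof ℂ ℕ (GradedPiece (filtration v ρ q α κ)
          (filtrationLT v ρ q α κ)) d) := by
  apply le_antisymm
  · rw [TwistedSkewGroupAlgebra.homogeneous_eq_iSup, Submodule.map_iSup]
    refine iSup_le fun g => ?_
    rintro _ ⟨_, ⟨a, ha, rfl⟩, rfl⟩
    rw [← QuantumSymmetricAlgebra.map_tensorComponent] at ha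
    obtain ⟨a, ha, rfl⟩ := ha
    exact (mem_range_lof_iff _ _).2 ⟨_, symb_term hΦ g ha⟩
  · have hle : (TwistedSkewGroupAlgebra.homogeneous (tensorAction ρ) α (tensorComponent V) d) ≤
        {carrier := {z | ∃ x ∈ TwistedSkewGroupAlgebra.homogeneous φ α
            (QuantumSymmetricAlgebra.component v q) d, Symb v ρ q α κ d (proj v ρ q α κ z) (Φ x)}
         zero_mem' := ⟨0, zero_mem _, by simpa only [map_zero] using IsSymbol.zero⟩
         add_mem' := by
          rintro z z' ⟨x, hx, h⟩ ⟨x', hx', h'⟩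
          exact ⟨x + x', add_mem hx hx', by simpa only [map_add] using h.add h'⟩
         smul_mem' := by
          rintro c z ⟨x, hx, h⟩
          exact ⟨c • x, Submodule.smul_mem _ c hx, by simpa only [map_smul] using h.smul c⟩ :
          Submodule ℂ (TwistedTensor ρ α)} := by
      rw [TwistedSkewGroupAlgebra.homogeneous_eq_iSup]
      refine iSup_le fun g => ?_
      rintro _ ⟨a, ha, rfl⟩
      refine ⟨_, TwistedSkewGroupAlgebra.term_mem_homogeneous _ _ g ?_, symb_term hΦ g ha⟩
      rw [← QuantumSymmetricAlgebra.map_tensorComponent]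
      exact Submodule.mem_map_of_mem ha
    intro y hy
    obtain ⟨x, hx⟩ := (mem_range_lof_iff _ _).1 hy
    obtain ⟨_, ⟨z, hz, rfl⟩, l, hl, hzl⟩ := Submodule.mem_sup.1 (filtration_le_sup d hx.1)
    obtain ⟨x', hx', h⟩ := hle hz
    refine ⟨x', hx', h.eq_of_sub_mem hx ?_⟩
    rw [← hzl]
    simpa using hl

theorem symb_monomial (hΦ : IsSymbolMap Φ) (p : (Fin n → ℕ) × G) :
    Symb v ρ q α κ (∑ i, p.1 i) (monomial v ρ q α κ p) (Φ (TwistedSkewGroupAlgebra.term φ α p.2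
      (orderedMonomial (fun i => QuantumSymmetricAlgebra.ι v q (v i)) p.1))) := by
  rw [← TwistedSkewGroupAlgebra.inclusion_mul_term, map_mul, map_orderedMonomial,
    map_orderedMonomial]
  exact (IsSymbol.orderedMonomial (fun i => hΦ.vec (v i)) p.1).mul_of_eq (hΦ.grp p.2) (add_zero _)

/-- Every symbol of degree `d` is the symbol of a combination of ordered monomials of degree `d`. -/
theorem exists_monomials_of_homogeneous (hΦ : IsSymbolMap Φ) {d : ℕ}
    {x : TwistedSkewGroupAlgebra φ α}
    (hx : x ∈ TwistedSkewGroupAlgebra.homogeneous φ α (QuantumSymmetricAlgebra.component v q) d) :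
    ∃ z ∈ Submodule.span ℂ (monomial v ρ q α κ '' {p | ∑ i, p.1 i = d}),
      Symb v ρ q α κ d z (Φ x) := by
  have hle : (TwistedSkewGroupAlgebra.homogeneous φ α (QuantumSymmetricAlgebra.component v q) d) ≤
      Submodule.span ℂ ((fun p : (Fin n → ℕ) × G => TwistedSkewGroupAlgebra.term φ α p.2
        (orderedMonomial (fun i => QuantumSymmetricAlgebra.ι v q (v i)) p.1)) ''
          {p | ∑ i, p.1 i = d}) := by
    rw [TwistedSkewGroupAlgebra.homogeneous_eq_iSup]
    refine iSup_le fun g => (Submodule.map_mono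
      (QuantumSymmetricAlgebra.component_le_span v q d)).trans ?_
    rw [Submodule.map_span, Submodule.span_le]
    rintro _ ⟨_, ⟨m, hm, rfl⟩, rfl⟩
    exact Submodule.subset_span ⟨(m, g), hm, rfl⟩
  refine Submodule.span_induction ?_ ⟨0, zero_mem _, ?_⟩ ?_ ?_ (hle hx)
  · rintro _ ⟨p, hp, rfl⟩
    refine ⟨_, Submodule.subset_span ⟨p, hp, rfl⟩, ?_⟩
    have hp : ∑ i, p.1 i = d := hp
    exact hp ▸ symb_monomial hΦ p
  · simpa only [map_zero] using IsSymbol.zero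
  · rintro x x' _ _ ⟨z, hz, h⟩ ⟨z', hz', h'⟩
    exact ⟨z + z', add_mem hz hz', by simpa only [map_add] using h.add h'⟩
  · rintro c x _ ⟨z, hz, h⟩
    exact ⟨c • z, Submodule.smul_mem _ c hz, by simpa only [map_smul] using h.smul c⟩

theorem filtration_le_span (hΦ : IsSymbolMap Φ) (d : ℕ) : filtration v ρ q α κ d ≤
    Submodule.span ℂ (monomial v ρ q α κ '' {p | ∑ i, p.1 i ≤ d}) := by
  induction d using Nat.strong_induction_on with
  | _ d ih =>
    intro x hx
    have hy := (mem_range_lof_iff (filtration v ρ q α κ) (filtrationLT v ρ q α κ)).2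
      ⟨x, hx, rfl⟩
    rw [← map_homogeneous hΦ] at hy
    obtain ⟨x', hx', h⟩ := hy
    obtain ⟨z, hz, hzx⟩ := exists_monomials_of_homogeneous hΦ hx'
    have hsub : x - z ∈ filtrationLT v ρ q α κ d := by
      have h1 : Symb v ρ q α κ d x (Φ x') := ⟨hx, h.symm⟩
      have h2 := h1.add (hzx.smul (-1))
      rw [neg_one_smul, neg_one_smul, add_neg_cancel, ← sub_eq_add_neg] at h2
      exact h2.eq_zero_iff.1 rfl
    have hlt : filtrationLT v ρ q α κ d ≤
        Submodule.span ℂ (monomial v ρ q α κ '' {p | ∑ i, p.1 i ≤ d}) :=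
      iSup₂_le fun k hk => (ih k hk).trans (Submodule.span_mono (Set.image_mono
        fun p (hp : _ ≤ _) => hp.trans hk.le))
    have hle : Submodule.span ℂ (monomial v ρ q α κ '' {p | ∑ i, p.1 i = d}) ≤
        Submodule.span ℂ (monomial v ρ q α κ '' {p | ∑ i, p.1 i ≤ d}) :=
      Submodule.span_mono (Set.image_mono fun p (hp : _ = _) => hp.le)
    rw [← sub_add_cancel x z]
    exact add_mem (hlt hsub) (hle hz)

theorem symbolMap_surjective (hΦ : IsSymbolMap Φ) : Function.Surjective Φ := by
  rw [← AlgHom.coe_toLinearMap, ← LinearMap.range_eq_top, eq_top_iff, ← iSup_range_lof]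
  refine iSup_le fun d => ?_
  rw [← map_homogeneous hΦ]
  exact LinearMap.map_le_range

/-- If the ordered monomials of `H_{q,κ,α}` are linearly independent, so are their symbols, which
are the images of the ordered monomials spanning `S_q(V) #_α G`. -/
theorem symbolMap_injective (hΦ : IsSymbolMap Φ) (hind : LinearIndependent ℂ (monomial v ρ q α κ)) :
    Function.Injective Φ := by
  let s (p : (Fin n → ℕ) × G) : TwistedSkewGroupAlgebra φ α :=
    TwistedSkewGroupAlgebra.term φ α p.2
      (orderedMonomial (fun i => QuantumSymmetricAlgebra.ι v q (v i)) p.1)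
  have hspan : ⊤ ≤ Submodule.span ℂ (Set.range s) := by
    have hterm : ∀ g a, TwistedSkewGroupAlgebra.term φ α g a ∈ Submodule.span ℂ (Set.range s) := by
      intro g a
      have ha : a ∈ (⊤ : Submodule ℂ (QuantumSymmetricAlgebra v q)) := trivial
      rw [← QuantumSymmetricAlgebra.iSup_component] at ha
      have hle : ⨆ d, QuantumSymmetricAlgebra.component v q d ≤
          (Submodule.span ℂ (Set.range s)).comap (TwistedSkewGroupAlgebra.term φ α g) := by
        refine iSup_le fun d => (QuantumSymmetricAlgebra.component_le_span v q d).trans ?_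
        rw [Submodule.span_le]
        rintro _ ⟨m, -, rfl⟩
        exact Submodule.subset_span ⟨(m, g), rfl⟩
      exact hle ha
    intro x _
    induction x using TwistedSkewGroupAlgebra.induction with
    | h0 => exact zero_mem _
    | hadd x y hx hy => exact add_mem (hx trivial) (hy trivial)
    | hterm g a => exact hterm g a
  let μ (d : ℕ) (p : {p : (Fin n → ℕ) × G // ∑ i, p.1 i = d}) : filtration v ρ q α κ d :=
    ⟨monomial v ρ q α κ p, by
      have := (symb_monomial hΦ p.1).1
      rwa [p.2] at this⟩
  -- monomials of degree `d` are independent modulo `F_{<d}`, which monomials of smaller degree span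
  have hpiece : ∀ d, LinearIndependent ℂ fun p =>
      GradedPiece.mk (filtration v ρ q α κ) (filtrationLT v ρ q α κ) d (μ d p) := by
    intro d
    have hμ : LinearIndependent ℂ (μ d) :=
      LinearIndependent.of_comp (filtration v ρ q α κ d).subtype
        (hind.comp (fun p : {p : (Fin n → ℕ) × G // ∑ i, p.1 i = d} => p.1)
          Subtype.val_injective)
    refine hμ.map (Submodule.disjoint_def.2 fun x hx hx' => ?_)
    have h1 : (x : QuantumHecke v ρ q α κ) ∈
        Submodule.span ℂ (monomial v ρ q α κ '' {p | ∑ i, p.1 i = d}) := by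
      have := Submodule.mem_map_of_mem (f := (filtration v ρ q α κ d).subtype) hx
      rw [Submodule.map_span] at this
      refine Submodule.span_mono ?_ this
      rintro _ ⟨_, ⟨p, rfl⟩, rfl⟩
      exact ⟨p.1, p.2, rfl⟩
    have h2 : (x : QuantumHecke v ρ q α κ) ∈
        Submodule.span ℂ (monomial v ρ q α κ '' {p | ∑ i, p.1 i < d}) := by
      have hx' : (x : QuantumHecke v ρ q α κ) ∈ filtrationLT v ρ q α κ d := by
        have := (GradedPiece.mk_eq_mk_iff _ _ x 0).1 ((LinearMap.mem_ker.1 hx').trans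
          (map_zero _).symm)
        simpa using this
      have hlt : filtrationLT v ρ q α κ d ≤
          Submodule.span ℂ (monomial v ρ q α κ '' {p | ∑ i, p.1 i < d}) :=
        iSup₂_le fun k hk => (filtration_le_span hΦ k).trans (Submodule.span_mono
          (Set.image_mono fun p (hp : _ ≤ _) => lt_of_le_of_lt hp hk))
      exact hlt hx'
    have hdisj : Disjoint {p : (Fin n → ℕ) × G | ∑ i, p.1 i = d} {p | ∑ i, p.1 i < d} :=
      Set.disjoint_left.2 fun p (hp : _ = _) (hp' : _ < _) => hp'.ne hp
    exact Subtype.ext (Submodule.disjoint_def.1 (hind.disjoint_span_image hdisj) _ h1 h2)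
  have hsymb : LinearIndependent ℂ fun p => Φ (s p) := by
    have h := (linearIndependent_lof _ hpiece).comp
      (fun p : (Fin n → ℕ) × G => ⟨∑ i, p.1 i, p, rfl⟩)
      (fun p p' h => congrArg
        (fun x : Σ d, {p : (Fin n → ℕ) × G // ∑ i, p.1 i = d} => x.2.1) h)
    have heq : (fun p => Φ (s p)) = fun p => DirectSum.lof ℂ ℕ (GradedPiece (filtration v ρ q α κ)
        (filtrationLT v ρ q α κ)) (∑ i, p.1 i) (GradedPiece.mk _ _ _ (μ _ ⟨p, rfl⟩)) :=
      funext fun p => (symb_monomial hΦ p).2.symm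
    rw [heq]
    exact h
  refine (injective_iff_map_eq_zero Φ).2 fun x hx => ?_
  obtain ⟨c, rfl⟩ := Finsupp.mem_span_range_iff_exists_finsupp.1
    (hspan (Submodule.mem_top (x := x)))
  have hc : c = 0 := by
    refine linearIndependent_iff.1 hsymb c ?_
    rw [Finsupp.linearCombination_apply, ← hx, map_finsuppSum]
    simp only [map_smul]
  rw [hc, Finsupp.sum_zero_index]

end SymbolMap

/-- Under the conditions on `κ`, the algebra `H_{q,κ,α}` is a twisted quantum Drinfeld Hecke
algebra. -/
theorem isTwistedQuantumDrinfeldHecke_of_conditions [Finite G] (hq_ne : ∀ i j, q i j ≠ 0)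
    (hq_diag : ∀ i, q i i = 1) (hq_inv : ∀ i j, q j i = (q i j)⁻¹)
    (hlam : ∀ g i, ρ g (v i) = lam g i • v i)
    (hk : HeckeConditions q α lam (bracketCoeff v α κ)) :
    IsTwistedQuantumDrinfeldHecke v ρ q α κ := by
  have := Fintype.ofFinite G
  obtain ⟨φ, hφ⟩ := QuantumSymmetricAlgebra.exists_action v q ρ lam hlam
  obtain ⟨Φ, hΦ⟩ := exists_symbolMap (κ := κ) (α := α) hφ
  let e := AlgEquiv.ofBijective Φ ⟨symbolMap_injective hΦ
    (linearIndependent_monomial hq_ne hq_diag hq_inv hlam hk), symbolMap_surjective hΦ⟩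
  refine ⟨φ, hφ, e.symm, fun d => ?_⟩
  rw [← map_homogeneous hΦ]
  ext x
  simp only [Submodule.mem_map]
  constructor
  · rintro ⟨_, ⟨y, hy, rfl⟩, rfl⟩
    convert hy
    exact e.symm_apply_apply y
  · intro hx
    exact ⟨_, ⟨x, hx, rfl⟩, e.symm_apply_apply x⟩

end QuantumHecke

end Hecke

/-! ### Necessity of the conditions on `κ` -/

section GradedPiece

variable {A : Type*} [Ring A] [Algebra ℂ A] {F Flt : ℕ → Submodule ℂ A}

theorem GradedPiece.finiteDimensional (d : ℕ) [FiniteDimensional ℂ (F d)] :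
    FiniteDimensional ℂ (GradedPiece F Flt d) :=
  inferInstanceAs (FiniteDimensional ℂ ((F d) ⧸ (Flt d).submoduleOf (F d)))

theorem GradedPiece.finrank_add (d : ℕ) [FiniteDimensional ℂ (F d)] (h : Flt d ≤ F d) :
    Module.finrank ℂ (GradedPiece F Flt d) + Module.finrank ℂ (Flt d) = Module.finrank ℂ (F d) := by
  rw [← (Submodule.submoduleOfEquivOfLe h).finrank_eq]
  exact Submodule.finrank_quotient_add_finrank _

theorem card_le_finrank_gradedPiece [IsRingFiltration F Flt] {B I : Type*} [Ring B] [Algebra ℂ B]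
    [Fintype I] (e : AssociatedGraded F Flt ≃ₐ[ℂ] B) (d : ℕ) [FiniteDimensional ℂ (F d)]
    {x : I → B} (hind : LinearIndependent ℂ x)
    (hx : ∀ i, x i ∈ (LinearMap.range (DirectSum.lof ℂ ℕ (GradedPiece F Flt) d)).map
      e.toLinearMap) :
    Fintype.card I ≤ Module.finrank ℂ (GradedPiece F Flt d) := by
  have hy : ∀ i, ∃ y, e (DirectSum.lof ℂ ℕ (GradedPiece F Flt) d y) = x i := fun i => by
    obtain ⟨_, ⟨y, rfl⟩, h⟩ := hx i
    exact ⟨y, h⟩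
  choose y hy using hy
  have : FiniteDimensional ℂ (GradedPiece F Flt d) := GradedPiece.finiteDimensional d
  refine LinearIndependent.fintype_card_le_finrank (b := y) (LinearIndependent.of_comp
    (e.toLinearMap ∘ₗ DirectSum.lof ℂ ℕ (GradedPiece F Flt) d) ?_)
  rw [show (e.toLinearMap ∘ₗ DirectSum.lof ℂ ℕ (GradedPiece F Flt) d) ∘ y = x from funext hy]
  exact hind

end GradedPiece

section Hecke

variable {G V : Type*} [Group G] [AddCommGroup V] [Module ℂ V] {n : ℕ}

namespace QuantumHecke

section

variable (v : Module.Basis (Fin n) ℂ V) (ρ : Representation ℂ G V) (q : Fin n → Fin n → ℂ)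
  (α : NormalizedTwoCocycle G) (κ : V →ₗ[ℂ] V →ₗ[ℂ] TwistedGroupAlgebra α)

/-- The elements `t_g` and `v_i t_g` of `H_{q,κ,α}`. -/
def lowMonomial (p : Option (Fin n) × G) : QuantumHecke v ρ q α κ :=
  p.1.elim 1 (fun i => vec v ρ q α κ (v i)) * grp v ρ q α κ p.2

theorem filtration_one_le_span :
    filtration v ρ q α κ 1 ≤ Submodule.span ℂ (Set.range (lowMonomial v ρ q α κ)) := by
  rw [filtration, Submodule.map_le_iff_le_comap]
  refine iSup₂_le fun k hk => ?_
  rw [TwistedSkewGroupAlgebra.homogeneous_eq_iSup]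
  refine iSup_le fun g => ?_
  rintro _ ⟨a, ha, rfl⟩
  change proj v ρ q α κ (TwistedSkewGroupAlgebra.term _ _ g a) ∈
    Submodule.span ℂ (Set.range (lowMonomial v ρ q α κ))
  rw [proj_term]
  rw [SetLike.mem_coe, tensorComponent] at ha
  interval_cases k
  · rw [pow_zero] at ha
    obtain ⟨r, rfl⟩ := Submodule.mem_one.1 ha
    rw [AlgHom.commutes, ← Algebra.smul_def]
    exact Submodule.smul_mem _ _ (Submodule.subset_span ⟨(none, g), by simp [lowMonomial]⟩)
  · rw [pow_one] at ha
    obtain ⟨x, rfl⟩ := ha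
    rw [ofTensor_ι, ← v.sum_repr x, map_sum, Finset.sum_mul]
    refine Submodule.sum_mem _ fun i _ => ?_
    rw [map_smul, smul_mul_assoc]
    exact Submodule.smul_mem _ _ (Submodule.subset_span ⟨(some i, g), rfl⟩)

end

variable {v : Module.Basis (Fin n) ℂ V} {ρ : Representation ℂ G V} {q : Fin n → Fin n → ℂ}
  {α : NormalizedTwoCocycle G} {κ : V →ₗ[ℂ] V →ₗ[ℂ] TwistedGroupAlgebra α} {lam : G → Fin n → ℂ}

/-- In a twisted quantum Drinfeld Hecke algebra the elements `t_g` and `v_i t_g` are linearly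
independent, by a dimension count in the first two degrees of the associated graded algebra. -/
theorem linearIndependent_lowMonomial [Fintype G]
    (h : IsTwistedQuantumDrinfeldHecke v ρ q α κ) :
    LinearIndependent ℂ (lowMonomial v ρ q α κ) := by
  obtain ⟨φ, -, e, he⟩ := h
  have hfin : FiniteDimensional ℂ (Submodule.span ℂ (Set.range (lowMonomial v ρ q α κ))) :=
    FiniteDimensional.span_of_finite ℂ (Set.finite_range _)
  have hfin1 : FiniteDimensional ℂ (filtration v ρ q α κ 1) :=
    Submodule.finiteDimensional_of_le (filtration_one_le_span v ρ q α κ)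
  have h01 : filtration v ρ q α κ 0 ≤ filtration v ρ q α κ 1 :=
    IsFiltration.mono (F := filtration v ρ q α κ) (F_lt := filtrationLT v ρ q α κ) zero_le_one
  have hLT : filtrationLT v ρ q α κ 1 = filtration v ρ q α κ 0 :=
    le_antisymm (iSup₂_le fun k hk => by rw [Nat.lt_one_iff.1 hk])
      (filtration_le_filtrationLT zero_lt_one)
  have hfin0 : FiniteDimensional ℂ (filtration v ρ q α κ 0) := Submodule.finiteDimensional_of_le h01
  have hcard0 : Fintype.card (Σ _ : G, Unit) ≤
      Module.finrank ℂ (GradedPiece (filtration v ρ q α κ) (filtrationLT v ρ q α κ) 0) := by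
    refine card_le_finrank_gradedPiece e 0 (TwistedSkewGroupAlgebra.linearIndependent_term φ α
      (a := fun _ : Unit => (1 : QuantumSymmetricAlgebra v q)) ?_) fun p => ?_
    · exact LinearIndependent.of_subsingleton () (QuantumSymmetricAlgebra.one_ne_zero' v q)
    · rw [he]
      refine TwistedSkewGroupAlgebra.term_mem_homogeneous _ _ _ ?_
      rw [QuantumSymmetricAlgebra.component, pow_zero]
      exact Submodule.one_le.1 le_rfl
  have hcard1 : Fintype.card (Σ _ : G, Fin n) ≤
      Module.finrank ℂ (GradedPiece (filtration v ρ q α κ) (filtrationLT v ρ q α κ) 1) := by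
    refine card_le_finrank_gradedPiece e 1 (TwistedSkewGroupAlgebra.linearIndependent_term φ α
      (a := fun i => QuantumSymmetricAlgebra.ι v q (v i)) ?_) fun p => ?_
    · exact v.linearIndependent.map' _
        (LinearMap.ker_eq_bot.2 (QuantumSymmetricAlgebra.ι_injective v q))
    · rw [he]
      refine TwistedSkewGroupAlgebra.term_mem_homogeneous _ _ _ ?_
      rw [QuantumSymmetricAlgebra.component, pow_one]
      exact ⟨_, rfl⟩
  have h0 := GradedPiece.finrank_add (F := filtration v ρ q α κ) (Flt := filtrationLT v ρ q α κ) 0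
    (iSup₂_le fun k hk => absurd hk (Nat.not_lt_zero k))
  have h1 := GradedPiece.finrank_add (F := filtration v ρ q α κ) (Flt := filtrationLT v ρ q α κ) 1
    (hLT.trans_le h01)
  have hle := Submodule.finrank_mono (filtration_one_le_span v ρ q α κ)
  rw [hLT] at h1
  rw [linearIndependent_iff_card_le_finrank_span, Set.finrank]
  refine le_trans ?_ hle
  rw [← h1]
  simp only [Fintype.card_sigma, Fintype.card_unit, Finset.sum_const, Finset.card_univ,
    Fintype.card_fin, smul_eq_mul, mul_one, Fintype.card_prod, Fintype.card_option] at *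
  rw [add_mul, one_mul, mul_comm n]
  exact add_le_add hcard1 (hcard0.trans (by omega))

/-- The coefficient functionals of the independent elements `t_g` and `v_i t_g`. -/
theorem exists_coefficient (h : LinearIndependent ℂ (lowMonomial v ρ q α κ))
    (p : Option (Fin n) × G) :
    ∃ ψ : QuantumHecke v ρ q α κ →ₗ[ℂ] ℂ, ψ (lowMonomial v ρ q α κ p) = 1 ∧
      ∀ p' ≠ p, ψ (lowMonomial v ρ q α κ p') = 0 := by
  classical
  obtain ⟨ψ, hψ⟩ := LinearMap.exists_extend (Finsupp.lapply p ∘ₗ h.repr)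
  have hval : ∀ p', ψ (lowMonomial v ρ q α κ p') = Finsupp.single p' (1 : ℂ) p := fun p' => by
    have := LinearMap.congr_fun hψ ⟨lowMonomial v ρ q α κ p', Submodule.subset_span ⟨p', rfl⟩⟩
    simpa [h.repr_eq_single p' ⟨lowMonomial v ρ q α κ p', Submodule.subset_span ⟨p', rfl⟩⟩ rfl]
      using this
  exact ⟨ψ, by simp [hval], fun p' hp' => by simp [hval, hp']⟩

/-- The two ways of reordering a product of three generators, with brackets `P`, `Q`, `R`. -/
theorem reorder_three {B : Type*} [Ring B] [Algebra ℂ B] {x y z P Q R : B} {a b c : ℂ}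
    (hxy : x * y = a • (y * x) + P) (hxz : x * z = b • (z * x) + Q)
    (hyz : y * z = c • (z * y) + R) :
    (a * b) • (R * x) + a • (y * Q) + P * z = (c * b) • (z * P) + c • (Q * y) + x * R := by
  have h1 : x * y * z = (a * b * c) • (z * y * x) + (a * b) • (R * x) + a • (y * Q) + P * z := by
    rw [hxy, add_mul, smul_mul_assoc, mul_assoc, hxz, mul_add, mul_smul_comm, ← mul_assoc, hyz,
      add_mul, smul_mul_assoc]
    simp only [smul_add, smul_smul, mul_assoc]
  have h2 : x * (y * z) = (a * b * c) • (z * y * x) + (c * b) • (z * P) + c • (Q * y) + x * R := by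
    rw [hyz, mul_add, mul_smul_comm, ← mul_assoc, hxz, add_mul, smul_mul_assoc, mul_assoc z, hxy,
      mul_add, mul_smul_comm]
    simp only [smul_add, smul_smul, mul_assoc]
    rw [show c * (b * a) = a * (b * c) by ring]
  rw [mul_assoc, h2] at h1
  have h3 := sub_eq_zero.2 h1
  rw [← sub_eq_zero, ← neg_eq_zero, ← h3]
  abel

/-- The elements `t_g` and `v_i t_g` being linearly independent, comparing coefficients in
`t_h v_i v_j` gives invariance of `κ`, and in `v_i v_j v_l` the quantum Jacobi identity. -/
theorem conditions_of_isTwistedQuantumDrinfeldHecke [Finite G]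
    (hlam : ∀ g i, ρ g (v i) = lam g i • v i)
    (hswap : ∀ i j, κ (v i) (v j) = -(q i j • κ (v j) (v i)))
    (h : IsTwistedQuantumDrinfeldHecke v ρ q α κ) :
    HeckeConditions q α lam (bracketCoeff v α κ) := by
  have := Fintype.ofFinite G
  have hind := linearIndependent_lowMonomial h
  have hgv : ∀ g i, grp v ρ q α κ g * vec v ρ q α κ (v i)
      = lam g i • (vec v ρ q α κ (v i) * grp v ρ q α κ g) := fun g i => by
    rw [grp_mul_vec, hlam, map_smul, smul_mul_assoc]
  refine ⟨fun i j g => ?_, fun i j l g hij hli hlj hk => ?_, fun i j g a => ?_⟩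
  · simp [bracketCoeff, hswap i j]
  · obtain ⟨ψ, hψ1, hψ0⟩ := exists_coefficient hind (some l, g)
    have hzero : ∀ i' f, i' ≠ l →
        ψ (vec v ρ q α κ (v i') * grp v ρ q α κ f) = 0 := fun i' f hi' =>
      hψ0 (some i', f) (by simp [hi'])
    have hrel := reorder_three (vec_mul_vec v ρ q α κ i j) (vec_mul_vec v ρ q α κ i l)
      (vec_mul_vec v ρ q α κ j l)
    have hone : ∀ c : G → ℂ,
        ψ (∑ f, c f • (vec v ρ q α κ (v l) * grp v ρ q α κ f)) = c g := fun c => by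
      rw [map_sum, Finset.sum_eq_single g]
      · rw [map_smul, show ψ (vec v ρ q α κ (v l) * grp v ρ q α κ g) = 1 from hψ1, smul_eq_mul,
          mul_one]
      · intro f _ hf
        rw [map_smul, show ψ (vec v ρ q α κ (v l) * grp v ρ q α κ f) = 0 from
          hψ0 (some l, f) (by simp [hf]), smul_zero]
      · simp
    have hcoef := congrArg ψ hrel
    simp only [Finset.sum_mul, Finset.mul_sum, smul_mul_assoc, mul_smul_comm, hgv, smul_smul,
      map_add, map_smul, hone] at hcoef
    simp only [map_sum, map_smul, hzero i _ hli.symm, hzero j _ hlj.symm, smul_eq_mul, mul_zero,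
      Finset.sum_const_zero, zero_add, add_zero] at hcoef
    rw [mul_comm] at hcoef
    rw [mul_right_cancel₀ hk hcoef, mul_comm]
  · classical
    obtain ⟨ψ, hψ1, hψ0⟩ := exists_coefficient hind (none, g * a)
    have hψ : ∀ f, ψ (grp v ρ q α κ f) = if f = g * a then 1 else 0 := fun f => by
      have hlow : grp v ρ q α κ f = lowMonomial v ρ q α κ (none, f) := by simp [lowMonomial]
      rw [hlow]
      split_ifs with hf
      · rw [hf, hψ1]
      · exact hψ0 _ (by simp [hf])
    set K := ∑ f, bracketCoeff v α κ i j f • grp v ρ q α κ f with hK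
    have hK' : K = vec v ρ q α κ (v i) * vec v ρ q α κ (v j)
        - q i j • (vec v ρ q α κ (v j) * vec v ρ q α κ (v i)) := by
      rw [vec_mul_vec v ρ q α κ i j, add_sub_cancel_left]
    have hcomm : ∀ i j, grp v ρ q α κ g * (vec v ρ q α κ (v i) * vec v ρ q α κ (v j))
        = (lam g i * lam g j) • (vec v ρ q α κ (v i) * vec v ρ q α κ (v j) * grp v ρ q α κ g) :=
      fun i j => by
        rw [← mul_assoc, hgv, smul_mul_assoc, mul_assoc, hgv, mul_smul_comm, smul_smul, mul_assoc]
    have hrel : grp v ρ q α κ g * K = (lam g i * lam g j) • (K * grp v ρ q α κ g) := by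
      rw [hK', mul_sub, mul_smul_comm, hcomm, hcomm, sub_mul, smul_sub, smul_mul_assoc,
        smul_comm (q i j), mul_comm (lam g j)]
    have hcoef := congrArg ψ hrel
    rw [hK, Finset.mul_sum, Finset.sum_mul] at hcoef
    simp only [map_sum, map_smul, mul_smul_comm, smul_mul_assoc, grp_mul, hψ, smul_eq_mul,
      mul_right_inj] at hcoef
    have hiff : ∀ f, f * g = g * a ↔ f = g * a * g⁻¹ := fun f => by
      rw [eq_mul_inv_iff_mul_eq]
    simp only [hiff, mul_ite, mul_one, mul_zero, Finset.sum_ite_eq', Finset.mem_univ,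
      if_true] at hcoef
    rw [mul_comm (α g a : ℂ), hcoef, mul_assoc (lam g i * lam g j)]

/-- The characterisation of the parameters of twisted quantum Drinfeld Hecke algebras. -/
theorem mem_parameterSpace_iff [Finite G] (hq_ne : ∀ i j, q i j ≠ 0)
    (hq_diag : ∀ i, q i i = 1) (hq_inv : ∀ i j, q j i = (q i j)⁻¹)
    (hlam : ∀ g i, ρ g (v i) = lam g i • v i) :
    κ ∈ parameterSpace v ρ q α ↔ HeckeConditions q α lam (bracketCoeff v α κ) := by
  refine ⟨fun h => conditions_of_isTwistedQuantumDrinfeldHecke hlam h.1 h.2, fun h => ⟨?_,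
    isTwistedQuantumDrinfeldHecke_of_conditions hq_ne hq_diag hq_inv hlam h⟩⟩
  intro i j
  refine TwistedSkewGroupAlgebra.ext fun g => ?_
  simpa [bracketCoeff] using h.swap i j g

end QuantumHecke

end Hecke

/-! ### The basis of the space of parameters -/

section Hecke

variable {G V : Type*} [Group G] [AddCommGroup V] [Module ℂ V] {n : ℕ}

/-- The scalar `α(g,a) / α(gag⁻¹,g)`, for which `t_g t_a t_g⁻¹` is the corresponding multiple of
`t_{gag⁻¹}`. -/
def conjFactor (α : NormalizedTwoCocycle G) (g a : G) : ℂ := (α g a : ℂ) / α (g * a * g⁻¹) g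

theorem conjFactor_mul (α : NormalizedTwoCocycle G) (h g a : G) :
    conjFactor α (h * g) a = conjFactor α h (g * a * g⁻¹) * conjFactor α g a := by
  have hconj : h * g * a * (h * g)⁻¹ = h * (g * a * g⁻¹) * h⁻¹ := by group
  rw [conjFactor, conjFactor, conjFactor, hconj]
  set b := g * a * g⁻¹ with hb
  set b' := h * b * h⁻¹ with hb'
  have hbg : b * g = g * a := by rw [hb]; group
  have hbh : b' * h = h * b := by rw [hb']; group
  -- the identity follows from three instances of the cocycle condition
  have c1 : (α h g : ℂ) * α (h * g) a = α g a * α h (g * a) := by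
    exact_mod_cast congrArg Units.val (α.cocycle h g a)
  have c2 : (α h b : ℂ) * α (h * b) g = α b g * α h (g * a) := by
    have := congrArg Units.val (α.cocycle h b g)
    rw [hbg] at this
    exact_mod_cast this
  have c3 : (α b' h : ℂ) * α (h * b) g = α h g * α b' (h * g) := by
    have := congrArg Units.val (α.cocycle b' h g)
    rw [hbh] at this
    exact_mod_cast this
  have e1 := Units.ne_zero (α h g)
  have e2 := Units.ne_zero (α b' (h * g))
  have e3 := Units.ne_zero (α b' h)
  have e4 := Units.ne_zero (α b g)
  have e5 := Units.ne_zero (α (h * b) g)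
  have e6 := Units.ne_zero (α h (g * a))
  rw [div_mul_div_comm, div_eq_div_iff e2 (mul_ne_zero e3 e4)]
  refine mul_left_cancel₀ (mul_ne_zero e1 (mul_ne_zero e5 e6)) ?_
  linear_combination (α (h * b) g : ℂ) * α h (g * a) * α b' h * α b g * c1
    - (α h (g * a) : ℂ) * α g a * α h g * α b' (h * g) * c2
    + (α h (g * a) : ℂ) * α g a * α b g * α h (g * a) * c3

theorem HeckeConditions.coeff_conj {q : Fin n → Fin n → ℂ} {α : NormalizedTwoCocycle G}
    {lam : G → Fin n → ℂ} {k : Fin n → Fin n → G → ℂ} (h : HeckeConditions q α lam k)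
    (i j : Fin n) (g a : G) :
    lam g i * lam g j * k i j (g * a * g⁻¹) = conjFactor α g a * k i j a := by
  rw [conjFactor, div_mul_eq_mul_div, eq_div_iff (Units.ne_zero _)]
  exact h.conj i j g a

section

variable {α : NormalizedTwoCocycle G} {lam : G → Fin n → ℂ}

open Classical in
/-- The coefficient of `t_b` in the sum over coset representatives that defines `f_{r,s,a}`. -/
def orbitCoeff (α : NormalizedTwoCocycle G) (lam : G → Fin n → ℂ) (T : Finset G) (r s : Fin n)
    (a b : G) : ℂ :=
  ∑ g ∈ T, if g * a * g⁻¹ = b then conjFactor α g a * (lam g r)⁻¹ * (lam g s)⁻¹ else 0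

theorem orbitCoeff_eq_zero {T : Finset G} {r s : Fin n} {a b : G} (h : ¬ IsConj a b) :
    orbitCoeff α lam T r s a b = 0 :=
  Finset.sum_eq_zero fun g _ => if_neg fun hg => h (isConj_iff.2 ⟨g, hg⟩)

/-- At `gag⁻¹` the coefficient is given by the formula for `g`, whether or not `g` is one of the
chosen coset representatives, since centralizing elements contribute the factor one. -/
theorem orbitCoeff_conj (hmul : ∀ g h i, lam (g * h) i = lam g i * lam h i)
    (hne : ∀ g i, lam g i ≠ 0) {T : Finset G} {r s : Fin n} {a : G}
    (hT : Subgroup.IsComplement (T : Set G) (Subgroup.centralizer {a} : Set G))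
    (hadm : ∀ h ∈ Subgroup.centralizer {a}, lam h r * lam h s = (α h a : ℂ) / α a h) (g : G) :
    orbitCoeff α lam T r s a (g * a * g⁻¹) = conjFactor α g a * (lam g r)⁻¹ * (lam g s)⁻¹ := by
  classical
  have hcent : ∀ c ∈ Subgroup.centralizer {a}, c * a * c⁻¹ = a := fun c hc => by
    rw [Subgroup.mem_centralizer_singleton_iff.1 hc, mul_inv_cancel_right]
  obtain ⟨⟨⟨t, ht⟩, ⟨c, hc⟩⟩, htc, huniq⟩ := hT.existsUnique g
  have htc : t * c = g := htc
  have hconj : t * a * t⁻¹ = g * a * g⁻¹ := by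
    conv_lhs => rw [← hcent c hc]
    rw [← htc]
    group
  rw [orbitCoeff, Finset.sum_eq_single t]
  · rw [if_pos hconj, ← htc, conjFactor_mul, hcent c hc, hmul, hmul]
    have h1 : conjFactor α c a = lam c r * lam c s := by
      rw [hadm c hc, conjFactor, hcent c hc]
    rw [h1]
    have := hne c r
    have := hne c s
    have := hne t r
    have := hne t s
    field_simp
  · intro t' ht' hne'
    refine if_neg fun h => hne' ?_
    have hmem : t'⁻¹ * g ∈ Subgroup.centralizer {a} := by
      rw [Subgroup.mem_centralizer_singleton_iff]
      have : t' * a = g * a * g⁻¹ * t' := by rw [← h, inv_mul_cancel_right]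
      calc t'⁻¹ * g * a = t'⁻¹ * (g * a * g⁻¹ * t') * (t'⁻¹ * g) := by group
        _ = a * (t'⁻¹ * g) := by rw [← this, inv_mul_cancel_left]
    have := huniq (⟨t', ht'⟩, ⟨t'⁻¹ * g, hmem⟩) (mul_inv_cancel_left t' g)
    exact congrArg (fun x => (x.1 : G)) this
  · exact fun h => absurd ht h

end

variable (v : Module.Basis (Fin n) ℂ V) (q : Fin n → Fin n → ℂ)
  (α : NormalizedTwoCocycle G) (lam : G → Fin n → ℂ)

theorem bracketCoeff_add (κ κ' : V →ₗ[ℂ] V →ₗ[ℂ] TwistedGroupAlgebra α) (i j : Fin n) (g : G) :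
    bracketCoeff v α (κ + κ') i j g = bracketCoeff v α κ i j g + bracketCoeff v α κ' i j g := by
  simp [bracketCoeff]

theorem bracketCoeff_smul (c : ℂ) (κ : V →ₗ[ℂ] V →ₗ[ℂ] TwistedGroupAlgebra α) (i j : Fin n)
    (g : G) : bracketCoeff v α (c • κ) i j g = c * bracketCoeff v α κ i j g := by
  simp [bracketCoeff]

theorem bracketCoeff_zero (i j : Fin n) (g : G) :
    bracketCoeff v α (0 : V →ₗ[ℂ] V →ₗ[ℂ] TwistedGroupAlgebra α) i j g = 0 := by
  simp [bracketCoeff]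

theorem bracketCoeff_basisMap (T : Finset G) (r s : Fin n) (a : G) (i j : Fin n) (b : G) :
    bracketCoeff v α (basisMap v q α lam T r s a) i j b
      = ((if i = r then 1 else 0) * (if j = s then 1 else 0)
          - q s r * (if i = s then 1 else 0) * (if j = r then 1 else 0))
        * orbitCoeff α lam T r s a b := by
  classical
  rw [bracketCoeff, basisMap, Module.Basis.constr_basis, Module.Basis.constr_basis, map_smul,
    smul_eq_mul, map_sum, orbitCoeff]
  congr 1
  refine Finset.sum_congr rfl fun g _ => ?_
  rw [map_smul, TwistedGroupAlgebra.t, TwistedSkewGroupAlgebra.coeff_term, smul_eq_mul, mul_ite,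
    mul_one, mul_zero]
  rfl

/-- The space of the bilinear maps that satisfy the conditions for a twisted quantum Drinfeld Hecke
algebra. -/
def conditionSubmodule : Submodule ℂ (V →ₗ[ℂ] V →ₗ[ℂ] TwistedGroupAlgebra α) where
  carrier := {κ | HeckeConditions q α lam (bracketCoeff v α κ)}
  zero_mem' := by
    refine ⟨fun i j g => ?_, fun i j l g _ _ _ h => absurd (bracketCoeff_zero v α i j g) h,
      fun i j h a => ?_⟩ <;> simp [bracketCoeff_zero]
  add_mem' {κ κ'} hκ hκ' := by
    refine ⟨fun i j g => ?_, fun i j l g hij hli hlj h => ?_, fun i j h a => ?_⟩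
    · rw [bracketCoeff_add, bracketCoeff_add, hκ.swap, hκ'.swap]
      ring
    · by_cases h0 : bracketCoeff v α κ i j g = 0
      · rw [bracketCoeff_add, h0, zero_add] at h
        exact hκ'.lam_eq i j l g hij hli hlj h
      · exact hκ.lam_eq i j l g hij hli hlj h0
    · rw [bracketCoeff_add, bracketCoeff_add, mul_add, mul_add, add_mul, hκ.conj, hκ'.conj]
  smul_mem' c κ hκ := by
    refine ⟨fun i j g => ?_, fun i j l g hij hli hlj h => ?_, fun i j h a => ?_⟩
    · rw [bracketCoeff_smul, bracketCoeff_smul, hκ.swap]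
      ring
    · rw [bracketCoeff_smul] at h
      exact hκ.lam_eq i j l g hij hli hlj (right_ne_zero_of_mul h)
    · rw [bracketCoeff_smul, bracketCoeff_smul]
      linear_combination c * hκ.conj i j h a

variable {v q α lam} {R : Set G} {T : G → Finset G}

theorem basisMap_mem_conditionSubmodule (hq_ne : ∀ i j, q i j ≠ 0)
    (hq_inv : ∀ i j, q j i = (q i j)⁻¹)
    (hone : ∀ i, lam 1 i = 1) (hmul : ∀ g h i, lam (g * h) i = lam g i * lam h i)
    (hne : ∀ g i, lam g i ≠ 0) {S : Finset G} {r s : Fin n} {a : G}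
    (hS : Subgroup.IsComplement (S : Set G) (Subgroup.centralizer {a} : Set G))
    (hadm : IsAdmissible q α lam r s a) :
    basisMap v q α lam S r s a ∈ conditionSubmodule v q α lam := by
  obtain ⟨hrs, hjac, hcent⟩ := hadm
  have hqq : ∀ i j, q i j * q j i = 1 := fun i j => by
    rw [hq_inv i j, mul_inv_cancel₀ (hq_ne i j)]
  -- as a rewrite rule, `hq_inv` would apply to its own right-hand side
  clear hq_inv hq_ne
  refine ⟨fun i j g => ?_, fun i j l g hij hli hlj h => ?_, fun i j h b => ?_⟩
  · simp only [bracketCoeff_basisMap]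
    by_cases h1 : i = r <;> by_cases h2 : j = s <;> by_cases h3 : i = s <;> by_cases h4 : j = r <;>
      simp_all [hrs.ne, hrs.ne']
    rw [← mul_assoc, hqq, one_mul]
  · rw [bracketCoeff_basisMap] at h
    have hconj : IsConj a g := by
      by_contra hc
      exact h (by rw [orbitCoeff_eq_zero hc, mul_zero])
    obtain ⟨c, rfl⟩ := isConj_iff.1 hconj
    have hlam : lam (c * a * c⁻¹) l = lam a l := by
      rw [hmul, hmul, mul_right_comm, ← hmul, mul_inv_cancel, hone, one_mul]
    have hcase : i = r ∧ j = s ∨ i = s ∧ j = r := by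
      by_contra hc
      refine left_ne_zero_of_mul h ?_
      by_cases h1 : i = r <;> by_cases h2 : j = s <;> by_cases h3 : i = s <;>
        by_cases h4 : j = r <;> simp_all
    rw [hlam]
    rcases hcase with ⟨rfl, rfl⟩ | ⟨rfl, rfl⟩
    · exact (hjac l hli hlj).symm
    · rw [mul_comm]
      exact (hjac l hlj hli).symm
  · rw [bracketCoeff_basisMap, bracketCoeff_basisMap]
    have hkey : lam h r * lam h s * orbitCoeff α lam S r s a (h * b * h⁻¹)
          * α (h * b * h⁻¹) h = α h b * orbitCoeff α lam S r s a b := by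
      by_cases hconj : IsConj a b
      · obtain ⟨c, rfl⟩ := isConj_iff.1 hconj
        rw [show h * (c * a * c⁻¹) * h⁻¹ = h * c * a * (h * c)⁻¹ by group,
          orbitCoeff_conj hmul hne hS hcent, orbitCoeff_conj hmul hne hS hcent, conjFactor_mul,
          hmul, hmul, conjFactor.eq_def α h,
          show h * (c * a * c⁻¹) * h⁻¹ = h * c * a * (h * c)⁻¹ by group]
        have := hne c r
        have := hne c s
        have := hne h r
        have := hne h s
        have := Units.ne_zero (α (h * c * a * (h * c)⁻¹) h)
        field_simp
      · rw [orbitCoeff_eq_zero hconj, orbitCoeff_eq_zero, mul_zero, zero_mul, mul_zero]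
        exact fun h' => hconj (h'.trans (isConj_iff.2 ⟨h⁻¹, by group⟩))
    have hpair : ∀ x : ℂ, lam h i * lam h j * (((if i = r then 1 else 0) * (if j = s then 1 else 0)
          - q s r * (if i = s then 1 else 0) * (if j = r then 1 else 0)) * x)
        = ((if i = r then 1 else 0) * (if j = s then 1 else 0)
          - q s r * (if i = s then 1 else 0) * (if j = r then 1 else 0))
          * (lam h r * lam h s * x) := fun x => by
      by_cases h1 : i = r <;> by_cases h2 : j = s <;> by_cases h3 : i = s <;>
        by_cases h4 : j = r <;> (simp_all; try ring)
    rw [hpair, mul_assoc, hkey]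
    ring

/-- The coefficients of `f_{r,s,a}` at admissible triples `(r', s', a')` are Kronecker
symbols. -/
theorem bracketCoeff_basisMap_eq_ite [DecidableEq G] (hR : ∀ g : G, ∃! a : G, a ∈ R ∧ IsConj a g)
    (hone : ∀ i, lam 1 i = 1) (hmul : ∀ g h i, lam (g * h) i = lam g i * lam h i)
    (hne : ∀ g i, lam g i ≠ 0) {S : Finset G} {x y : Fin n × Fin n × G}
    (hS : Subgroup.IsComplement (S : Set G) (Subgroup.centralizer {x.2.2} : Set G))
    (hxR : x.2.2 ∈ R) (hx : IsAdmissible q α lam x.1 x.2.1 x.2.2) (hyR : y.2.2 ∈ R)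
    (hy : y.1 < y.2.1) :
    bracketCoeff v α (basisMap v q α lam S x.1 x.2.1 x.2.2) y.1 y.2.1 y.2.2
      = if y = x then 1 else 0 := by
  obtain ⟨r, s, a⟩ := x
  obtain ⟨r', s', a'⟩ := y
  obtain ⟨hrs, -, hcent⟩ := hx
  simp only at *
  have hswap : ¬ (r' = s ∧ s' = r) := by
    rintro ⟨rfl, rfl⟩
    exact lt_asymm hrs hy
  rw [bracketCoeff_basisMap]
  by_cases ha : a' = a
  · subst ha
    have h1 : orbitCoeff α lam S r s a' a' = 1 := by
      have := orbitCoeff_conj hmul hne hS hcent 1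
      simpa [conjFactor, hone, α.map_one_left, α.map_one_right] using this
    rw [h1]
    by_cases h1 : r' = r <;> by_cases h2 : s' = s <;> by_cases h3 : r' = s <;>
      by_cases h4 : s' = r <;> simp_all
  · rw [orbitCoeff_eq_zero, mul_zero, if_neg]
    · simp [ha]
    · intro hconj
      exact ha ((hR a').unique ⟨hyR, IsConj.refl _⟩ ⟨hxR, hconj⟩)

theorem ext_of_bracketCoeff {κ κ' : V →ₗ[ℂ] V →ₗ[ℂ] TwistedGroupAlgebra α}
    (h : ∀ i j g, bracketCoeff v α κ i j g = bracketCoeff v α κ' i j g) : κ = κ' :=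
  v.ext fun i => v.ext fun j => TwistedSkewGroupAlgebra.ext fun g => h i j g

/-- All coefficients of a bilinear map satisfying the conditions vanish if those at the admissible
triples do: by invariance and antisymmetry, a nonzero coefficient of `κ(v_i,v_j)` makes a triple
admissible. -/
theorem bracketCoeff_eq_zero (hq_diag : ∀ i, q i i = 1)
    (hR : ∀ g : G, ∃! a : G, a ∈ R ∧ IsConj a g) (hne : ∀ g i, lam g i ≠ 0)
    {κ : V →ₗ[ℂ] V →ₗ[ℂ] TwistedGroupAlgebra α}
    (hκ : HeckeConditions q α lam (bracketCoeff v α κ))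
    (h0 : ∀ r s a, a ∈ R → IsAdmissible q α lam r s a → bracketCoeff v α κ r s a = 0)
    (i j : Fin n) (g : G) : bracketCoeff v α κ i j g = 0 := by
  have hlt : ∀ i j g, i < j → bracketCoeff v α κ i j g = 0 := by
    intro i j g hij
    obtain ⟨a, ⟨haR, hconj⟩, -⟩ := hR g
    obtain ⟨c, rfl⟩ := isConj_iff.1 hconj
    have hc := hκ.coeff_conj i j c a
    have ha : bracketCoeff v α κ i j a = 0 := by
      by_contra hk
      refine hk (h0 i j a haR ⟨hij, fun l hli hlj => (hκ.lam_eq i j l a hij.ne hli hlj hk).symm,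
        fun h hh => ?_⟩)
      have hha : h * a * h⁻¹ = a := by
        rw [Subgroup.mem_centralizer_singleton_iff.1 hh, mul_inv_cancel_right]
      have := hκ.coeff_conj i j h a
      rw [conjFactor, hha] at this
      exact mul_right_cancel₀ hk this
    rw [ha, mul_zero] at hc
    exact (mul_eq_zero.1 hc).resolve_left (mul_ne_zero (hne c i) (hne c j))
  rcases lt_trichotomy i j with h | rfl | h
  · exact hlt i j g h
  · have := hκ.swap i i g
    rwa [hq_diag, one_mul, self_eq_neg] at this
  · rw [hκ.swap, hlt j i g h, mul_zero, neg_zero]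

end Hecke

theorem mainTheorem3 {G V : Type*} [Group G] [Finite G] [AddCommGroup V] [Module ℂ V] {n : ℕ}
    (v : Module.Basis (Fin n) ℂ V) (ρ : Representation ℂ G V)
    (q : Fin n → Fin n → ℂ) (hq_ne : ∀ i j, q i j ≠ 0) (hq_diag : ∀ i, q i i = 1)
    (hq_inv : ∀ i j, q j i = (q i j)⁻¹)
    (α : NormalizedTwoCocycle G)
    (lam : G → Fin n → ℂ) (hlam : ∀ g i, ρ g (v i) = lam g i • v i)
    (R : Set G) (hR : ∀ g : G, ∃! a : G, a ∈ R ∧ IsConj a g)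
    (T : G → Finset G)
    (hT : ∀ a ∈ R, Subgroup.IsComplement (T a : Set G) (Subgroup.centralizer {a} : Set G)) :
    ∃ P : Submodule ℂ (V →ₗ[ℂ] V →ₗ[ℂ] TwistedGroupAlgebra α),
      (P : Set (V →ₗ[ℂ] V →ₗ[ℂ] TwistedGroupAlgebra α)) = parameterSpace v ρ q α ∧
      ∃ b : Module.Basis
          {x : Fin n × Fin n × G // x.2.2 ∈ R ∧ IsAdmissible q α lam x.1 x.2.1 x.2.2} ℂ P,
        ∀ x, (b x : V →ₗ[ℂ] V →ₗ[ℂ] TwistedGroupAlgebra α)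
          = basisMap v q α lam (T x.1.2.2) x.1.1 x.1.2.1 x.1.2.2 := by
  classical
  have hone := eigenvalue_one hlam
  have hmul := eigenvalue_mul hlam
  have hne := eigenvalue_ne_zero hlam
  refine ⟨conditionSubmodule v q α lam, Set.ext fun κ =>
    (QuantumHecke.mem_parameterSpace_iff hq_ne hq_diag hq_inv hlam).symm, ?_⟩
  let X := {x : Fin n × Fin n × G // x.2.2 ∈ R ∧ IsAdmissible q α lam x.1 x.2.1 x.2.2}
  have := Fintype.ofFinite X
  let coords : conditionSubmodule v q α lam →ₗ[ℂ] X → ℂ :=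
    { toFun := fun κ x => bracketCoeff v α κ x.1.1 x.1.2.1 x.1.2.2
      map_add' := fun κ κ' => funext fun x => bracketCoeff_add v α _ _ _ _ _
      map_smul' := fun c κ => funext fun x => bracketCoeff_smul v α _ _ _ _ _ }
  let f (x : X) : conditionSubmodule v q α lam :=
    ⟨basisMap v q α lam (T x.1.2.2) x.1.1 x.1.2.1 x.1.2.2,
      basisMap_mem_conditionSubmodule hq_ne hq_inv hone hmul hne (hT _ x.2.1) x.2.2⟩
  have hf : ∀ x, coords (f x) = Pi.single x 1 := fun x => funext fun y => by
    refine (bracketCoeff_basisMap_eq_ite hR hone hmul hne (hT _ x.2.1) x.2.1 x.2.2 y.2.1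
      y.2.2.1).trans ?_
    rw [Pi.single_apply]
    exact if_congr Subtype.ext_iff.symm rfl rfl
  have hinj : Function.Injective coords := by
    intro κ κ' h
    -- `κ + (-1) • κ'` is the difference, in a form not needing subtraction on the submodule
    refine Subtype.ext (ext_of_bracketCoeff (v := v) fun i j g => ?_)
    have h0 := bracketCoeff_eq_zero hq_diag hR hne (κ + (-1 : ℂ) • κ').2 (fun r s a ha hadm => by
      have := congrFun h ⟨(r, s, a), ha, hadm⟩
      have : bracketCoeff v α κ.1 r s a = bracketCoeff v α κ'.1 r s a := this
      rw [Submodule.coe_add, Submodule.coe_smul, bracketCoeff_add, bracketCoeff_smul, this]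
      ring) i j g
    rw [Submodule.coe_add, Submodule.coe_smul, bracketCoeff_add, bracketCoeff_smul] at h0
    linear_combination h0
  have hsurj : Function.Surjective coords := by
    refine LinearMap.range_eq_top.1 (eq_top_iff.2 fun c _ => ?_)
    rw [pi_eq_sum_univ' c]
    exact Submodule.sum_mem _ fun x _ => Submodule.smul_mem _ _ ⟨f x, hf x⟩
  refine ⟨Module.Basis.ofEquivFun (LinearEquiv.ofBijective coords ⟨hinj, hsurj⟩), fun x => ?_⟩
  have hx : Module.Basis.ofEquivFun (LinearEquiv.ofBijective coords ⟨hinj, hsurj⟩) x = f x := by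
    rw [Module.Basis.coe_ofEquivFun, LinearEquiv.symm_apply_eq]
    exact (hf x).symm
  rw [hx]

end
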